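/- Let $G=(V,E)$ be an infinite, connected, locally finite simple graph; for $y\in V$ let $N_y$ be the set of neighbors of $y$, and for $\Lambda\subseteq V$ put $\overleftarrow{\partial}\Lambda=\{x\in\Lambda:\exists y\in\Lambda^c,\ x\sim y\}$ and $\overrightarrow{\partial}\Lambda=\{y\in\Lambda^c:\exists x\in\Lambda,\ x\sim y\}$. Fix a root $o\in V$ and put $V_{0,1}=\{o\}$, $V_n=\bigcup_{y\in V_{0,n}}(\{y\}\cup N_y)$, $V_{0,n+1}=V_{0,n}\cup\overrightarrow{\partial}V_n$ for $n\ge 1$, $V_\infty=\bigcup_{n\ge1}V_{0,n}$, with the conventions $V_0=\emptyset$ and $\overrightarrow{\partial}V_0:=\{o\}$. Assume that every edge has one endpoint in $V_\infty$ and the other in $V\setminus V_\infty$. For $n\ge 0$ and $y\in\overrightarrow{\partial}V_n$ put $N_y^{(p)}=N_y\cap\overleftarrow{\partial}V_n$, $N_y^{(s)}=N_y\cap\overleftarrow{\partial}V_{n+1}$, $N_y^{(0)}=N_y\setminus(N_y^{(p)}\cup N_y^{(s)})$, and assume that $$N_y^{(0)}=\emptyset,\qquad N_y^{(s)}\cap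 N_z^{(s)}=\emptyset\qquad\text{for all } n\ge0 \text{ and all } y\neq z \text{ in } \overrightarrow{\partial}V_n .$$ For each $n\geq 0$ fix an enumeration $y^{(n)}_1,\dots,y^{(n)}_{k_n}$ of the (finite) set $\overrightarrow{\partial}V_n$. For each $x\in V$ let $\mathcal A_x$ be a finite-dimensional unital $C^*$-algebra. Let $\mathcal A_\Lambda=\bigotimes_{x\in\Lambda}\mathcal A_x$ for finite $\Lambda\subset V$, let $\mathcal A_{loc}=\bigcup_\Lambda\mathcal A_\Lambda$ be the local algebra (with $a\in\mathcal A_\Lambda$ identified with $a\otimes 1$), and let the quasi-local algebra $\mathcal A_V$ be its $C^*$-completion. Let $\varphi^{(0)}=\bigotimes_{x\in V}\varphi^{(0)}_x$ be a product state on $\mathcal A_V$, where $\varphi^{(0)}_x$ is a state on $\mathcal A_x$, and let $\varphi^{(0)}_\Lambda$ be its restriction to $\mathcal A_\Lambda$. For each $y\in V_\infty$ let $\mathcal E_y:\mathcal A_{\{y\}\cup N_y}\to\mathcal A_{N_y^{(s)}}$ be a completely positive, identity preserving linear map, and assume the compatibility condition $$\varphi^{(0)}_{N_y^{(s)}}\bigl(\mathcal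 E_y(a\otimes 1_{y}\otimes 1_{N_y^{(s)}})\bigr)=\varphi^{(0)}_{N_y^{(p)}}(a)\qquad\text{for all } y\in V_\infty \text{ and } a\in\mathcal A_{N_y^{(p)}}.$$ Extend each $\mathcal E_y$ to $\mathcal A_{loc}$ by the identity on the other tensor factors, put $\mathcal E_{n,n+1}=\mathcal E_{y^{(n)}_{k_n}}\circ\cdots\circ\mathcal E_{y^{(n)}_1}$, and $$\varphi_n=\varphi^{(0)}\circ\mathcal E_{n,n+1}\circ\cdots\circ\mathcal E_{0,1}\qquad\text{on }\mathcal A_{loc},\quad n\ge0.$$ Then: 1. For each $n\ge 0$, $\varphi_n$ extends uniquely to a state on $\mathcal A_V$, again denoted $\varphi_n$. 2. There is exactly one forward quantum Markov field $\varphi$ associated with $\varphi^{(0)}$ and $(\mathcal E_y)_{y\in V_\infty}$, that is, exactly one state on $\mathcal A_V$ that is a limit (cluster) point of the sequence $(\varphi_n)$ for pointwise convergence on $\mathcal A_V$. 3. The sequence $(\varphi_n)$ converges to $\varphi$, and to no other state, in the strongly finite sense: for every $a\in\mathcal A_{loc}$ there is $n_a$ such that $\varphi_n(a)=\varphi(a)$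 for all $n\ge n_a$. Moreover $\varphi_n(a)\to\varphi(a)$ for every $a\in\mathcal A_V$. -/

import Mathlib

open scoped TensorProduct ComplexOrder

noncomputable section

namespace QMF

universe u v

section StarTensor

variable {ι : Type u} (B : ι → Type v) [∀ i, Ring (B i)] [∀ i, StarRing (B i)]
  [∀ i, Algebra ℂ (B i)] [∀ i, StarModule ℂ (B i)]

/-- The involution of an algebraic tensor product of `*`-algebras, as an additive map:
`(c • ⨂ bᵢ)* = c̄ • ⨂ bᵢ*`. -/
def tensorStar : (⨂[ℂ] i, B i) →+ (⨂[ℂ] i, B i) :=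
  PiTensorProduct.liftAddHom
    (fun f : ℂ × (Π i, B i) => star f.1 • PiTensorProduct.tprod ℂ (star f.2))
    (fun r f i hf => by
      have : (star f) i = 0 := by simp [hf]
      simp [(PiTensorProduct.tprod ℂ).map_coord_zero i this])
    (fun f => by simp)
    (fun r f i m₁ m₂ => by
      have h : ∀ m : B i, star (Function.update f i m) = Function.update (star f) i (star m) := by
        intro m; ext j; by_cases hj : j = i
        · subst hj; simp
        · simp [hj]
      simp only [h, star_add, MultilinearMap.map_update_add, smul_add])
    (fun r r' f => by simp [add_smul])
    (fun r f i r' => by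
      have h : ∀ m : B i, star (Function.update f i m) = Function.update (star f) i (star m) := by
        intro m; ext j; by_cases hj : j = i
        · subst hj; simp
        · simp [hj]
      simp only [h, star_smul, MultilinearMap.map_update_smul]
      have : Function.update (star f) i (star (f i)) = star f := by
        rw [← Pi.star_apply, Function.update_eq_self]
      rw [this, smul_smul, star_mul, mul_comm])

theorem tensorStar_smul_tprod (c : ℂ) (b : Π i, B i) :
    tensorStar B (c • PiTensorProduct.tprod ℂ b) = star c • PiTensorProduct.tprod ℂ (star b) := by
  rw [← PiTensorProduct.tprodCoeff_eq_smul_tprod]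
  rfl

theorem tensorStar_tprod (b : Π i, B i) :
    tensorStar B (PiTensorProduct.tprod ℂ b) = PiTensorProduct.tprod ℂ (star b) := by
  simpa using tensorStar_smul_tprod B 1 b

instance instStarRingTensor : StarRing (⨂[ℂ] i, B i) where
  star := tensorStar B
  star_involutive x := by
    change tensorStar B (tensorStar B x) = x
    induction x using PiTensorProduct.induction_on with
    | smul_tprod r f => simp [tensorStar_smul_tprod]
    | add x y hx hy => simp [hx, hy]
  star_mul x y := by
    change tensorStar B (x * y) = tensorStar B y * tensorStar B x
    induction x using PiTensorProduct.induction_on with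
    | smul_tprod r f =>
      induction y using PiTensorProduct.induction_on with
      | smul_tprod s g =>
        simp only [smul_mul_smul_comm, PiTensorProduct.tprod_mul_tprod, tensorStar_smul_tprod,
          star_mul]
      | add x y hx hy => simp only [mul_add, add_mul, map_add, hx, hy]
    | add x y hx hy => simp only [mul_add, add_mul, map_add, hx, hy]
  star_add := map_add (tensorStar B)

theorem star_tprod (b : Π i, B i) :
    star (PiTensorProduct.tprod ℂ b : ⨂[ℂ] i, B i) = PiTensorProduct.tprod ℂ (star b) :=
  tensorStar_tprod B b

instance instStarModuleTensor : StarModule ℂ (⨂[ℂ] i, B i) where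
  star_smul c x := by
    change tensorStar B (c • x) = star c • tensorStar B x
    induction x using PiTensorProduct.induction_on with
    | smul_tprod r f => simp only [smul_smul, tensorStar_smul_tprod, star_mul, mul_comm]
    | add x y hx hy => simp only [smul_add, map_add, hx, hy]

end StarTensor

section CStarSeminorm

variable {B : Type v} [Ring B] [StarRing B] [Algebra ℂ B]

/-- A `C*`-seminorm on a `*`-algebra. -/
structure IsCStarSeminorm (p : Seminorm ℂ B) : Prop where
  mul_le : ∀ a b, p (a * b) ≤ p a * p b
  star_mul_self : ∀ a, p (star a * a) = p a ^ 2

theorem IsCStarSeminorm.one_le {p : Seminorm ℂ B} (hp : IsCStarSeminorm p) : p 1 ≤ 1 := by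
  have h := hp.star_mul_self 1
  simp only [star_one, mul_one] at h
  nlinarith [apply_nonneg p 1, sq_nonneg (p 1 - 1)]

theorem IsCStarSeminorm.unitary_le {p : Seminorm ℂ B} (hp : IsCStarSeminorm p) {a : B}
    (ha : star a * a = 1) : p a ≤ 1 := by
  have h := hp.star_mul_self a
  rw [ha] at h
  have := hp.one_le
  by_contra hlt
  push Not at hlt
  nlinarith

theorem IsCStarSeminorm.star_eq {p : Seminorm ℂ B} (hp : IsCStarSeminorm p) (a : B) :
    p (star a) = p a := by
  have key : ∀ b, p b ≤ p (star b) := by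
    intro b
    have h := hp.star_mul_self b
    have h2 := hp.mul_le (star b) b
    rcases (apply_nonneg p b).eq_or_lt with h0 | h0
    · rw [← h0]; exact apply_nonneg p _
    · nlinarith
  refine le_antisymm ?_ (key a)
  simpa using key (star a)

theorem isCStarSeminorm_zero : IsCStarSeminorm (0 : Seminorm ℂ B) :=
  ⟨fun _ _ => by simp, fun _ => by simp⟩

variable (B) in
/-- The elements of a `*`-algebra on which all `C*`-seminorms are uniformly bounded. -/
def boundedPart : Subalgebra ℂ B where
  carrier := {a | ∃ C : ℝ, ∀ p : Seminorm ℂ B, IsCStarSeminorm p → p a ≤ C}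
  mul_mem' := by
    rintro a b ⟨C, hC⟩ ⟨D, hD⟩
    refine ⟨C * D, fun p hp => (hp.mul_le a b).trans ?_⟩
    exact mul_le_mul (hC p hp) (hD p hp) (apply_nonneg p b) ((apply_nonneg p a).trans (hC p hp))
  add_mem' := by
    rintro a b ⟨C, hC⟩ ⟨D, hD⟩
    exact ⟨C + D, fun p hp => (map_add_le_add p a b).trans (add_le_add (hC p hp) (hD p hp))⟩
  algebraMap_mem' c := by
    refine ⟨‖c‖, fun p hp => ?_⟩
    rw [Algebra.algebraMap_eq_smul_one, map_smul_eq_mul]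
    exact mul_le_of_le_one_right (norm_nonneg c) hp.one_le

/-- The largest `C*`-seminorm of a `*`-algebra: the supremum of all its `C*`-seminorms. -/
def maxCStarNorm (a : B) : ℝ := ⨆ p : {p : Seminorm ℂ B // IsCStarSeminorm p}, p.1 a

end CStarSeminorm

section LocalAlgebra

variable {V : Type u} (A : V → Type v) [∀ x, CStarAlgebra (A x)]

/-- The elementary tensors `⨂ₓ aₓ` with `aₓ = 1` for all `x` outside a finite set. -/
def localTensors : Set (⨂[ℂ] x, A x) :=
  {t | ∃ (Λ : Finset V) (a : Π x, A x), (∀ x ∉ Λ, a x = 1) ∧ PiTensorProduct.tprod ℂ a = t}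

/-- The algebra `𝒜_loc = ⋃_Λ 𝒜_Λ ⊗ 1` (the algebraic inductive limit of the `𝒜_Λ`) of local observables (`Λ` finite), as the `*`-subalgebra of
the algebraic tensor product of all the `𝒜ₓ` that is spanned by the elementary tensors with only
finitely many factors different from `1`. -/
def localSubalgebra : StarSubalgebra ℂ (⨂[ℂ] x, A x) where
  toSubalgebra := (Submodule.span ℂ (localTensors A)).toSubalgebra
    (Submodule.subset_span ⟨∅, 1, fun _ _ => rfl, rfl⟩)
    (fun s t hs ht => by
      classical
      refine Submodule.span_induction₂ (p := fun s t _ _ => s * t ∈ Submodule.span ℂ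
        (localTensors A)) ?_ ?_ ?_ ?_ ?_ ?_ ?_ hs ht
      · rintro _ _ ⟨Λ, a, ha, rfl⟩ ⟨M, b, hb, rfl⟩
        refine Submodule.subset_span ⟨Λ ∪ M, a * b, fun x hx => ?_, ?_⟩
        · rw [Finset.mem_union, not_or] at hx
          simp [ha x hx.1, hb x hx.2]
        · rw [PiTensorProduct.tprod_mul_tprod]
      · intro y _; simp
      · intro y _; simp
      · intro x y z _ _ _ h1 h2; rw [add_mul]; exact Submodule.add_mem _ h1 h2
      · intro x y z _ _ _ h1 h2; rw [mul_add]; exact Submodule.add_mem _ h1 h2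
      · intro r x y _ _ h; rw [smul_mul_assoc]; exact Submodule.smul_mem _ r h
      · intro r x y _ _ h; rw [mul_smul_comm]; exact Submodule.smul_mem _ r h)
  star_mem' := by
    intro s hs
    change s ∈ Submodule.span ℂ (localTensors A) at hs
    change star s ∈ Submodule.span ℂ (localTensors A)
    refine Submodule.span_induction (p := fun s _ => star s ∈ Submodule.span ℂ
        (localTensors A)) ?_ ?_ ?_ ?_ hs
    · rintro _ ⟨Λ, a, ha, rfl⟩
      refine Submodule.subset_span ⟨Λ, star a, fun x hx => by simp [ha x hx], ?_⟩
      rw [star_tprod]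
    · simp
    · intro x y _ _ h1 h2; rw [star_add]; exact Submodule.add_mem _ h1 h2
    · intro r x _ h; rw [star_smul]; exact Submodule.smul_mem _ _ h

/-- The local algebra `𝒜_loc`, as a type. -/
def LocalAlgebra : Type (max u v) := ↥(localSubalgebra A)

instance : Ring (LocalAlgebra A) := inferInstanceAs (Ring ↥(localSubalgebra A))
instance : StarRing (LocalAlgebra A) := inferInstanceAs (StarRing ↥(localSubalgebra A))
instance : Algebra ℂ (LocalAlgebra A) := inferInstanceAs (Algebra ℂ ↥(localSubalgebra A))
instance : StarModule ℂ (LocalAlgebra A) := inferInstanceAs (StarModule ℂ ↥(localSubalgebra A))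

variable {A} in
/-- The elementary tensor `⨂ₓ aₓ` as a local observable, where `aₓ = 1` off the finite set `Λ`. -/
def elementary (Λ : Finset V) (a : Π x, A x) (ha : ∀ x ∉ Λ, a x = 1) : LocalAlgebra A :=
  ⟨PiTensorProduct.tprod ℂ a, Submodule.subset_span ⟨Λ, a, ha, rfl⟩⟩

theorem elementary_mem_boundedPart (Λ : Finset V) :
    ∀ (a : Π x, A x) (ha : ∀ x ∉ Λ, a x = 1),
      elementary Λ a ha ∈ boundedPart (LocalAlgebra A) := by
  classical
  have hupd : ∀ (x : V) (c : A x), ∀ y ∉ ({x} : Finset V),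
      Function.update (1 : Π x, A x) x c y = 1 := by
    intro x c y hy
    rw [Function.update_of_ne (by simpa using hy)]; rfl
  have single : ∀ (x : V) (c : A x),
      elementary {x} (Function.update (1 : Π x, A x) x c) (hupd x c) ∈
        boundedPart (LocalAlgebra A) := by
    intro x c
    have hc : c ∈ Submodule.span ℂ (unitary (A x) : Set (A x)) := by
      rw [CStarAlgebra.span_unitary]; trivial
    induction hc using Submodule.span_induction with
    | mem u hu =>
      refine ⟨1, fun p hp => hp.unitary_le ?_⟩
      apply Subtype.ext
      change star (PiTensorProduct.tprod ℂ (Function.update (1 : Π x, A x) x u)) *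
        PiTensorProduct.tprod ℂ (Function.update (1 : Π x, A x) x u) = PiTensorProduct.tprod ℂ 1
      rw [star_tprod, PiTensorProduct.tprod_mul_tprod]
      congr 1
      ext y
      by_cases hy : y = x
      · subst hy; simpa using (Unitary.mem_iff.1 hu).1
      · simp [hy]
    | zero =>
      convert (boundedPart (LocalAlgebra A)).zero_mem
      apply Subtype.ext
      exact (PiTensorProduct.tprod ℂ).map_update_zero _ _
    | add c d _ _ h1 h2 =>
      convert (boundedPart (LocalAlgebra A)).add_mem h1 h2
      apply Subtype.ext
      exact (PiTensorProduct.tprod ℂ).map_update_add _ _ _ _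
    | smul r c _ h =>
      convert (boundedPart (LocalAlgebra A)).smul_mem h r
      apply Subtype.ext
      exact (PiTensorProduct.tprod ℂ).map_update_smul _ _ _ _
  induction Λ using Finset.induction_on with
  | empty =>
    intro a ha
    convert (boundedPart (LocalAlgebra A)).one_mem
    apply Subtype.ext
    change PiTensorProduct.tprod ℂ a = PiTensorProduct.tprod ℂ 1
    congr 1
    ext x
    exact ha x (by simp)
  | insert x Λ hx ih =>
    intro a ha
    have h' : ∀ y ∉ Λ, Function.update a x 1 y = 1 := by
      intro y hy
      by_cases hyx : y = x
      · subst hyx; simp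
      · rw [Function.update_of_ne hyx]; exact ha y (by simp [hyx, hy])
    convert (boundedPart (LocalAlgebra A)).mul_mem (single x (a x)) (ih _ h')
    apply Subtype.ext
    change PiTensorProduct.tprod ℂ a =
      PiTensorProduct.tprod ℂ (Function.update (1 : Π x, A x) x (a x)) *
        PiTensorProduct.tprod ℂ (Function.update a x 1)
    rw [PiTensorProduct.tprod_mul_tprod]
    congr 1
    ext y
    by_cases hyx : y = x
    · subst hyx; simp
    · simp [hyx]

theorem boundedPart_eq_top (a : LocalAlgebra A) : a ∈ boundedPart (LocalAlgebra A) := by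
  obtain ⟨t, ht⟩ := a
  change t ∈ Submodule.span ℂ (localTensors A) at ht
  induction ht using Submodule.span_induction with
  | mem t h =>
    obtain ⟨Λ, a, ha, rfl⟩ := h
    exact elementary_mem_boundedPart A Λ a ha
  | zero => exact (boundedPart (LocalAlgebra A)).zero_mem
  | add s t _ _ h1 h2 => exact (boundedPart (LocalAlgebra A)).add_mem h1 h2
  | smul r t _ h => exact (boundedPart (LocalAlgebra A)).smul_mem h r

theorem bddAbove_cStarSeminorms (a : LocalAlgebra A) :
    BddAbove (Set.range fun p : {p : Seminorm ℂ (LocalAlgebra A) // IsCStarSeminorm p} => p.1 a) := by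
  obtain ⟨C, hC⟩ := boundedPart_eq_top A a
  exact ⟨C, by rintro _ ⟨p, rfl⟩; exact hC p.1 p.2⟩

variable {A} in
theorem le_maxCStarNorm (p : Seminorm ℂ (LocalAlgebra A)) (hp : IsCStarSeminorm p)
    (a : LocalAlgebra A) : p a ≤ maxCStarNorm a :=
  le_ciSup (bddAbove_cStarSeminorms A a) ⟨p, hp⟩

variable {A} in
theorem maxCStarNorm_le {a : LocalAlgebra A} {C : ℝ}
    (h : ∀ p : Seminorm ℂ (LocalAlgebra A), IsCStarSeminorm p → p a ≤ C) : maxCStarNorm a ≤ C :=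
  haveI : Nonempty {p : Seminorm ℂ (LocalAlgebra A) // IsCStarSeminorm p} :=
    ⟨⟨0, isCStarSeminorm_zero⟩⟩
  ciSup_le fun p => h p.1 p.2

variable {A} in
theorem maxCStarNorm_nonneg (a : LocalAlgebra A) : 0 ≤ maxCStarNorm a :=
  le_maxCStarNorm 0 isCStarSeminorm_zero a

/-- The `C*`-norm of the local algebra. A tensor product of finitely many finite-dimensional
`C*`-algebras carries exactly one `C*`-norm, so that this is the usual norm on each `𝒜_Λ`. -/
def localNorm : RingSeminorm (LocalAlgebra A) where
  toFun := maxCStarNorm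
  map_zero' := le_antisymm (maxCStarNorm_le fun p _ => (map_zero p).le) (maxCStarNorm_nonneg 0)
  add_le' a b := maxCStarNorm_le fun p hp => (map_add_le_add p a b).trans
    (add_le_add (le_maxCStarNorm p hp a) (le_maxCStarNorm p hp b))
  neg' a := by simp [maxCStarNorm, map_neg_eq_map]
  mul_le' a b := maxCStarNorm_le fun p hp => (hp.mul_le a b).trans
    (mul_le_mul (le_maxCStarNorm p hp a) (le_maxCStarNorm p hp b) (apply_nonneg p b)
      (maxCStarNorm_nonneg a))

instance : SeminormedRing (LocalAlgebra A) := (localNorm A).toSeminormedRing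

theorem norm_def (a : LocalAlgebra A) : ‖a‖ = maxCStarNorm a := rfl

instance : NormedSpace ℂ (LocalAlgebra A) where
  norm_smul_le c a := by
    rw [norm_def, norm_def]
    refine maxCStarNorm_le fun p hp => ?_
    rw [map_smul_eq_mul]
    exact mul_le_mul_of_nonneg_left (le_maxCStarNorm p hp a) (norm_nonneg c)

theorem norm_star_local (a : LocalAlgebra A) : ‖star a‖ = ‖a‖ := by
  have key : ∀ b : LocalAlgebra A, ‖star b‖ ≤ ‖b‖ := fun b =>
    maxCStarNorm_le fun p hp => (hp.star_eq b).le.trans (le_maxCStarNorm p hp b)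
  exact le_antisymm (key a) (by simpa using key (star a))

theorem norm_star_mul_self_local (a : LocalAlgebra A) : ‖a‖ * ‖a‖ ≤ ‖star a * a‖ := by
  have h : ‖a‖ ≤ Real.sqrt ‖star a * a‖ := by
    refine maxCStarNorm_le fun p hp => Real.le_sqrt_of_sq_le ?_
    rw [← hp.star_mul_self]
    exact le_maxCStarNorm p hp _
  calc ‖a‖ * ‖a‖ ≤ Real.sqrt ‖star a * a‖ * Real.sqrt ‖star a * a‖ :=
        mul_self_le_mul_self (norm_nonneg a) h
    _ = ‖star a * a‖ := Real.mul_self_sqrt (norm_nonneg _)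

/-- The quasi-local algebra `𝒜_V`: the completion of the local algebra in its `C*`-norm. -/
abbrev QuasiLocalAlgebra : Type (max u v) := UniformSpace.Completion (LocalAlgebra A)

theorem isometry_star_local : Isometry (star : LocalAlgebra A → LocalAlgebra A) :=
  AddMonoidHomClass.isometry_of_norm (starAddEquiv : LocalAlgebra A ≃+ LocalAlgebra A)
    (norm_star_local A)

instance : Star (QuasiLocalAlgebra A) where
  star := UniformSpace.Completion.map star

theorem coe_star (a : LocalAlgebra A) :
    ((star a : LocalAlgebra A) : QuasiLocalAlgebra A) = star (a : QuasiLocalAlgebra A) :=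
  (UniformSpace.Completion.map_coe (isometry_star_local A).uniformContinuous a).symm

theorem continuous_star_quasi : Continuous (star : QuasiLocalAlgebra A → QuasiLocalAlgebra A) :=
  UniformSpace.Completion.continuous_map

open UniformSpace.Completion in
instance : StarRing (QuasiLocalAlgebra A) where
  star_involutive x := by
    have h := continuous_star_quasi A
    refine induction_on x (isClosed_eq (h.comp h) continuous_id) fun a => ?_
    rw [← coe_star, ← coe_star, star_star]
  star_mul x y := by
    have h := continuous_star_quasi A
    refine induction_on₂ x y (isClosed_eq (h.comp continuous_mul)
      ((h.comp continuous_snd).mul (h.comp continuous_fst))) fun a b => ?_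
    rw [← coe_mul, ← coe_star, ← coe_star, ← coe_star, star_mul, coe_mul]
  star_add x y := by
    have h := continuous_star_quasi A
    refine induction_on₂ x y (isClosed_eq (h.comp continuous_add)
      ((h.comp continuous_fst).add (h.comp continuous_snd))) fun a b => ?_
    rw [← coe_add, ← coe_star, ← coe_star, ← coe_star, star_add, coe_add]

open UniformSpace.Completion in
instance : CStarAlgebra (QuasiLocalAlgebra A) where
  norm_smul_le := norm_smul_le
  star_smul c x := by
    have h := continuous_star_quasi A
    refine induction_on x (isClosed_eq (h.comp (continuous_const_smul c))
      (h.const_smul (star c))) fun a => ?_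
    rw [← coe_smul, ← coe_star, ← coe_star, star_smul, coe_smul]
  norm_mul_self_le x := by
    have h := continuous_star_quasi A
    refine induction_on x (isClosed_le (continuous_norm.mul continuous_norm)
      (continuous_norm.comp (h.mul continuous_id))) fun a => ?_
    change ‖(a : QuasiLocalAlgebra A)‖ * ‖(a : QuasiLocalAlgebra A)‖ ≤
      ‖star (a : QuasiLocalAlgebra A) * (a : QuasiLocalAlgebra A)‖
    rw [← coe_star, ← coe_mul, norm_coe, norm_coe]
    exact norm_star_mul_self_local A a

variable {A} in
/-- The canonical map of the local algebra into the quasi-local algebra. -/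
def toQuasi : LocalAlgebra A →⋆ₐ[ℂ] QuasiLocalAlgebra A where
  toFun a := a
  map_one' := UniformSpace.Completion.coe_one _
  map_mul' := UniformSpace.Completion.coe_mul
  map_zero' := UniformSpace.Completion.coe_zero
  map_add' := UniformSpace.Completion.coe_add
  commutes' _ := rfl
  map_star' := coe_star A

end LocalAlgebra

section Localization

variable {V : Type u} (A : V → Type v) [∀ x, CStarAlgebra (A x)]

/-- The algebra `𝒜_Λ = ⨂_{x ∈ Λ} 𝒜ₓ` of observables localized in the finite region `Λ`. -/
abbrev RegionAlgebra (Λ : Finset V) : Type (max u v) := ⨂[ℂ] x : Λ, A x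

variable {A}

open Classical in
/-- The extension by `1` of a family over `Λ` to a family over `M`. -/
def extendByOne (Λ M : Finset V) (a : Π x : Λ, A x) : Π x : M, A x :=
  fun x => if hx : x.1 ∈ Λ then a ⟨x.1, hx⟩ else 1

theorem extendByOne_update [DecidableEq V] {Λ M : Finset V} (h : Λ ⊆ M) [DecidableEq Λ]
    (a : Π x : Λ, A x) (i : Λ) (e : A i) :
    extendByOne Λ M (Function.update a i e) =
      Function.update (extendByOne Λ M a) ⟨i.1, h i.2⟩ e := by
  ext x
  obtain ⟨x, hx⟩ := x
  obtain ⟨i, hi⟩ := i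
  by_cases hxi : x = i
  · subst hxi; simp [extendByOne, hi]
  · rw [Function.update_of_ne (by simpa using hxi)]
    simp only [extendByOne]
    split_ifs
    · rw [Function.update_of_ne (by simpa using hxi)]
    · rfl

open Classical in
/-- The family that agrees with `a` off `Λ` and is `1` on `Λ`. -/
def offPart (Λ : Finset V) (a : Π x, A x) : Π x, A x := fun x => if x ∈ Λ then 1 else a x

theorem offPart_update_of_mem [DecidableEq V] {Λ : Finset V} (a : Π x, A x) {i : V} (hi : i ∈ Λ)
    (e : A i) : offPart Λ (Function.update a i e) = offPart Λ a := by
  ext x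
  by_cases hx : x ∈ Λ
  · simp [offPart, hx]
  · have : x ≠ i := fun h => hx (h ▸ hi)
    simp [offPart, hx, this]

theorem offPart_update_of_notMem [DecidableEq V] {Λ : Finset V} (a : Π x, A x) {i : V}
    (hi : i ∉ Λ) (e : A i) :
    offPart Λ (Function.update a i e) = Function.update (offPart Λ a) i e := by
  ext x
  by_cases hxi : x = i
  · subst hxi; simp [offPart, hi]
  · simp [offPart, hxi]

theorem restrict_update_of_mem [DecidableEq V] {B : V → Type v} {Λ : Finset V} (a : Π x, B x) {i : V} (hi : i ∈ Λ)
    (e : B i) : (fun x : Λ => Function.update a i e x) =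
      Function.update (fun x : Λ => a x) ⟨i, hi⟩ e := by
  ext x
  obtain ⟨x, hx⟩ := x
  by_cases hxi : x = i
  · subst hxi; simp
  · rw [Function.update_of_ne (by simpa using hxi)]; simp [hxi]

theorem restrict_update_of_notMem [DecidableEq V] {B : V → Type v} {Λ : Finset V} (a : Π x, B x) {i : V}
    (hi : i ∉ Λ) (e : B i) : (fun x : Λ => Function.update a i e x) = fun x : Λ => a x := by
  ext x
  have : x.1 ≠ i := fun h => hi (h ▸ x.2)
  simp [this]

/-- The embedding `a ↦ a ⊗ 1` of `𝒜_Λ` into `𝒜_M`, for `Λ ⊆ M`. -/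
def regionInclusion {Λ M : Finset V} (h : Λ ⊆ M) : RegionAlgebra A Λ →ₗ[ℂ] RegionAlgebra A M :=
  PiTensorProduct.lift
    { toFun := fun a => PiTensorProduct.tprod ℂ (extendByOne Λ M a)
      map_update_add' := fun a i c d => by
        classical
        simp only [extendByOne_update h, MultilinearMap.map_update_add]
      map_update_smul' := fun a i c d => by
        classical
        simp only [extendByOne_update h, MultilinearMap.map_update_smul] }

open Classical in
/-- The embedding `a ↦ a ⊗ 1` of `𝒜_Λ` into the local algebra. -/
def regionToLocal (Λ : Finset V) : RegionAlgebra A Λ →ₗ[ℂ] LocalAlgebra A :=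
  LinearMap.codRestrict (Submodule.span ℂ (localTensors A))
    (PiTensorProduct.lift
      ((PiTensorProduct.tprod ℂ : MultilinearMap ℂ A _).domDomRestrict (fun x => x ∈ Λ) (fun _ => 1)))
    (fun t => by
      induction t using PiTensorProduct.induction_on with
      | smul_tprod r f =>
        rw [map_smul, PiTensorProduct.lift.tprod]
        refine Submodule.smul_mem _ _ (Submodule.subset_span ⟨Λ, _, fun x hx => ?_, rfl⟩)
        simp [hx]
      | add x y hx hy => rw [map_add]; exact Submodule.add_mem _ hx hy)

/-- `a ⊗ c ↦ E(a) ⊗ c` for `a ∈ 𝒜_Λ` and `c` a tensor over the complement of `Λ`, on the algebraic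
tensor product of all the `𝒜ₓ`. -/
def ampliationAux {Λ M : Finset V} (E : RegionAlgebra A Λ →ₗ[ℂ] RegionAlgebra A M) :
    (⨂[ℂ] x, A x) →ₗ[ℂ] (⨂[ℂ] x, A x) :=
  PiTensorProduct.lift
    { toFun := fun a =>
        ((localSubalgebra A).subtype (regionToLocal M (E (PiTensorProduct.tprod ℂ fun x : Λ => a x))) :
            ⨂[ℂ] x, A x) * PiTensorProduct.tprod ℂ (offPart Λ a)
      map_update_add' := fun a i c d => by
        by_cases hi : i ∈ Λ
        · classical
          simp only [restrict_update_of_mem _ hi, offPart_update_of_mem _ hi,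
            MultilinearMap.map_update_add, map_add]
          exact add_mul _ _ _
        · simp only [restrict_update_of_notMem _ hi, offPart_update_of_notMem _ hi,
            MultilinearMap.map_update_add, mul_add]
      map_update_smul' := fun a i c d => by
        by_cases hi : i ∈ Λ
        · classical
          simp only [restrict_update_of_mem _ hi, offPart_update_of_mem _ hi,
            MultilinearMap.map_update_smul, map_smul]
          exact smul_mul_assoc c _ _
        · simp only [restrict_update_of_notMem _ hi, offPart_update_of_notMem _ hi,
            MultilinearMap.map_update_smul, mul_smul_comm] }

theorem ampliationAux_mem {Λ M : Finset V} (E : RegionAlgebra A Λ →ₗ[ℂ] RegionAlgebra A M)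
    (t : ⨂[ℂ] x, A x) (ht : t ∈ Submodule.span ℂ (localTensors A)) :
    ampliationAux E t ∈ Submodule.span ℂ (localTensors A) := by
  classical
  induction ht using Submodule.span_induction with
  | mem t h =>
    obtain ⟨M', a, ha, rfl⟩ := h
    rw [ampliationAux, PiTensorProduct.lift.tprod]
    refine (localSubalgebra A).mul_mem (regionToLocal M _).2
      (Submodule.subset_span ⟨M', _, fun x hx => ?_, rfl⟩)
    simp [offPart, ha x hx]
  | zero => rw [map_zero]; exact Submodule.zero_mem _
  | add s t _ _ h1 h2 => rw [map_add]; exact Submodule.add_mem _ h1 h2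
  | smul r t _ h => rw [map_smul]; exact Submodule.smul_mem _ r h

/-- The extension `E ⊗ id` of a map `E : 𝒜_Λ → 𝒜_M` to the local algebra. -/
def ampliation {Λ M : Finset V} (E : RegionAlgebra A Λ →ₗ[ℂ] RegionAlgebra A M) :
    LocalAlgebra A →ₗ[ℂ] LocalAlgebra A :=
  LinearMap.restrict (ampliationAux E) (p := Submodule.span ℂ (localTensors A))
    (q := Submodule.span ℂ (localTensors A)) (ampliationAux_mem E)

end Localization

section States

/-- A state on a unital `C*`-algebra: a normalized positive linear functional. -/
structure IsState {B : Type v} [CStarAlgebra B] (ω : B →ₗ[ℂ] ℂ) : Prop where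
  nonneg : ∀ b, 0 ≤ ω (star b * b)
  map_one : ω 1 = 1

/-- A transition expectation: a completely positive, identity preserving linear map. Positive
elements of the matrix algebras are written as `Nᴴ * N`. -/
structure IsTransitionExpectation {B : Type u} {C : Type v} [Ring B] [StarRing B] [Algebra ℂ B]
    [Ring C] [StarRing C] [Algebra ℂ C] (E : B →ₗ[ℂ] C) : Prop where
  completelyPositive : ∀ (k : ℕ) (M : Matrix (Fin k) (Fin k) B),
    ∃ N : Matrix (Fin k) (Fin k) C, (M.conjTranspose * M).map E = N.conjTranspose * N
  map_one : E 1 = 1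

variable {V : Type u} {A : V → Type v} [∀ x, CStarAlgebra (A x)]

/-- `φ₀ = ⨂ₓ φₓ` is the product state on the quasi-local algebra with the one-site states `φₓ`. -/
structure IsProductState (φ₀ : QuasiLocalAlgebra A →ₗ[ℂ] ℂ) (φ : ∀ x, A x →ₗ[ℂ] ℂ) : Prop where
  isState : IsState φ₀
  isState_site : ∀ x, IsState (φ x)
  apply_elementary : ∀ (Λ : Finset V) (a : Π x, A x) (ha : ∀ x ∉ Λ, a x = 1),
    φ₀ (toQuasi (elementary Λ a ha)) = ∏ x ∈ Λ, φ x (a x)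

/-- The restriction `φ_Λ` of a functional on the quasi-local algebra to `𝒜_Λ`. -/
def restrictState (φ₀ : QuasiLocalAlgebra A →ₗ[ℂ] ℂ) (Λ : Finset V) : RegionAlgebra A Λ →ₗ[ℂ] ℂ :=
  φ₀ ∘ₗ toQuasi.toAlgHom.toLinearMap ∘ₗ regionToLocal Λ

end States

section Graph

variable {V : Type u} (G : SimpleGraph V)

/-- The internal boundary of a set of vertices. -/
def internalBoundary (Λ : Set V) : Set V := {x | x ∈ Λ ∧ ∃ y ∉ Λ, G.Adj x y}

/-- The external boundary of a set of vertices. -/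
def externalBoundary (Λ : Set V) : Set V := {y | y ∉ Λ ∧ ∃ x ∈ Λ, G.Adj x y}

/-- The union of the plaquettes `{y} ∪ N_y` at the points `y` of a set. -/
def plaquettes (Λ : Set V) : Set V := ⋃ y ∈ Λ, insert y (G.neighborSet y)

/-- The tessellation `V_{0,n}` with root `o`: `V_{0,1} = {o}` and `V_{0,n+1}` is the union of
`V_{0,n}` and the external boundary of `V_n`; by convention `V_{0,0} = ∅`. -/
def centers (o : V) : ℕ → Set V
  | 0 => ∅
  | 1 => {o}
  | n + 2 => centers o (n + 1) ∪ externalBoundary G (plaquettes G (centers o (n + 1)))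

/-- `V_n`, the union of the plaquettes at the points of `V_{0,n}`; in particular `V_0 = ∅`. -/
def ball (o : V) (n : ℕ) : Set V := plaquettes G (centers G o n)

/-- The external boundary of `V_n` for `n ≥ 1`, and `{o}` for `n = 0`. -/
def level (o : V) : ℕ → Set V
  | 0 => {o}
  | n + 1 => externalBoundary G (ball G o (n + 1))

/-- `V_∞ = ⋃_{n ≥ 1} V_{0,n}`. -/
def allCenters (o : V) : Set V := ⋃ n ≥ 1, centers G o n

open Classical in
/-- The plaquette `{y} ∪ N_y`. -/
def plaquette [G.LocallyFinite] (y : V) : Finset V := insert y (G.neighborFinset y)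

open Classical in
/-- The previous vertices `N_y^{(p)}` of a vertex `y` of the `n`-th level. -/
def prev [G.LocallyFinite] (o : V) (n : ℕ) (y : V) : Finset V :=
  {x ∈ G.neighborFinset y | x ∈ internalBoundary G (ball G o n)}

open Classical in
/-- The successors `N_y^{(s)}` of a vertex `y` of the `n`-th level. -/
def succ [G.LocallyFinite] (o : V) (n : ℕ) (y : V) : Finset V :=
  {x ∈ G.neighborFinset y | x ∈ internalBoundary G (ball G o (n + 1))}

open Classical in
/-- The neighbors `N_y^{(0)}` of `y` that are neither previous vertices nor successors. -/
def rest [G.LocallyFinite] (o : V) (n : ℕ) (y : V) : Finset V :=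
  G.neighborFinset y \ (prev G o n y ∪ succ G o n y)

theorem prev_subset_plaquette [G.LocallyFinite] (o : V) (n : ℕ) (y : V) :
    prev G o n y ⊆ plaquette G y := by
  classical
  exact (Finset.filter_subset _ _).trans (Finset.subset_insert _ _)

end Graph

section Field

variable {V : Type u} (G : SimpleGraph V) [G.LocallyFinite] (o : V)
  {A : V → Type v} [∀ x, CStarAlgebra (A x)]

/-- A map `E_y : 𝒜_{{y} ∪ N_y} → 𝒜_{N_y^{(s)}}` for each `n` and each vertex `y`. Only the maps with
`y` in the `n`-th level are used, and the levels are disjoint: this is a family indexed by `V_∞`. As `N_y^{(s)}` is disjoint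
from `{y} ∪ N_y^{(p)}`, the values commute with `𝒜_{{y} ∪ N_y^{(p)}}`: the Markov property with respect
to this algebra (or to `𝒜_{N_y^{(p)}}`) is the choice of the codomain `𝒜_{N_y^{(s)}}`. -/
abbrev TransitionFamily (A : V → Type v) [∀ x, CStarAlgebra (A x)] : Type (max u v) :=
  ∀ (n : ℕ) (y : V), RegionAlgebra A (plaquette G y) →ₗ[ℂ] RegionAlgebra A (succ G o n y)

variable {G o}

/-- `E_{y_k} ∘ ⋯ ∘ E_{y_1}` for the list `[y_1, …, y_k]`, each map being extended by the identity. -/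
def levelMap (E : TransitionFamily G o A) (n : ℕ) : List V → (LocalAlgebra A →ₗ[ℂ] LocalAlgebra A)
  | [] => LinearMap.id
  | y :: l => levelMap E n l ∘ₗ ampliation (E n y)

/-- `E_{n,n+1} ∘ ⋯ ∘ E_{0,1}`, where `E_{k,k+1}` is composed along the enumeration `enum k` of the
`k`-th level. -/
def forwardMap (E : TransitionFamily G o A) (enum : ℕ → List V) :
    ℕ → (LocalAlgebra A →ₗ[ℂ] LocalAlgebra A)
  | 0 => levelMap E 0 (enum 0)
  | n + 1 => levelMap E (n + 1) (enum (n + 1)) ∘ₗ forwardMap E enum n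

/-- `ψ` is the state `φ_n = φ₀ ∘ E_{n,n+1} ∘ ⋯ ∘ E_{0,1}` on the quasi-local algebra: a state that is
given by this formula on the local algebra, which is dense. (The range of the composed maps lies in
the algebra of the complement of the interior of `V_{n+1}`, where `φ₀` is the product of the
remaining one-site states.) -/
structure IsForwardState (φ₀ : QuasiLocalAlgebra A →ₗ[ℂ] ℂ) (E : TransitionFamily G o A)
    (enum : ℕ → List V) (n : ℕ) (ψ : QuasiLocalAlgebra A →ₗ[ℂ] ℂ) : Prop where
  isState : IsState ψ
  apply_local : ∀ a : LocalAlgebra A, ψ (toQuasi a) = φ₀ (toQuasi (forwardMap E enum n a))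

/-- A forward quantum Markov field: a state that is a pointwise limit point of the sequence of the
states `φ_n`. -/
def IsForwardQMF (φ₀ : QuasiLocalAlgebra A →ₗ[ℂ] ℂ) (E : TransitionFamily G o A)
    (enum : ℕ → List V) (ψ : QuasiLocalAlgebra A →ₗ[ℂ] ℂ) : Prop :=
  IsState ψ ∧ ∃ Φ : ℕ → (QuasiLocalAlgebra A →ₗ[ℂ] ℂ), (∀ n, IsForwardState φ₀ E enum n (Φ n)) ∧
    MapClusterPt (ψ : QuasiLocalAlgebra A → ℂ) Filter.atTop
      (fun n => (Φ n : QuasiLocalAlgebra A → ℂ))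

/-- Convergence of functionals to `φ` in the strongly finite sense: on each local observable the
sequence is eventually constant, with value given by `φ`. -/
def StronglyFiniteTendsto (Φ : ℕ → (QuasiLocalAlgebra A →ₗ[ℂ] ℂ))
    (φ : QuasiLocalAlgebra A →ₗ[ℂ] ℂ) : Prop :=
  ∀ a : LocalAlgebra A, ∃ n₀ : ℕ, ∀ n ≥ n₀, Φ n (toQuasi a) = φ (toQuasi a)

end Field

end QMF

end

/-! The heart of the matter is that `φ_n(a)` stops depending on `n`. Let `a` be supported in
`V_{n+1}`. Every map of the levels `0, …, n` takes its values in some `N_y^{(s)} ⊆ V_{n+1}`, so the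
image of `a` under these levels is still supported in `V_{n+1}`. A vertex `y` of level `n+1` lies
outside `V_{n+1}`, and so do its successors; since `N_y^{(0)} = ∅`, the plaquette of `y` meets
`V_{n+1}` only in `N_y^{(p)}`. There the compatibility condition, together with the factorization of
the product state over disjoint supports, says that `E_y ⊗ id` preserves `φ₀`
(`IsProductState.apply_ampliation`). Afterwards the support has gained only `N_y^{(s)}`, which
contains no vertex of the level, by bipartiteness, and no successor of another vertex of the level,
by hypothesis. So the argument repeats along the enumeration (`IsProductState.apply_levelMap`), and
`φ_{n+1}(a) = φ_n(a)`.

The rest is the passage from the local to the quasi-local algebra. Complete positivity makes each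
`E_y ⊗ id` positive (`ampliation_star_mul_self_mem`), so the formula for `φ_n` is a positive
normalized functional on the local algebra. The norm there is the largest `C*`-seminorm, and the
operator seminorm of a GNS representation is a `C*`-seminorm that dominates its functional; hence
positive normalized functionals are contractions (`norm_apply_le_of_positive`) and extend to states
(`exists_state_extension`). The eventual values of the `φ_n` form such a functional as well, whose
extension is the field. Contractivity spreads the convergence from the dense local algebra to the
whole algebra, and a sequence that converges in a Hausdorff topology has no cluster point besides
its limit. -/

noncomputable section

namespace QMF

universe u v

/-! ### The GNS seminorm of a positive functional -/

section PositiveFunctionals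

variable {B : Type v} [Ring B] [StarRing B] [Algebra ℂ B] [StarModule ℂ B]

/-- A sesquilinear form `(a, b) ↦ f (a* b)` with nonnegative diagonal is hermitian. -/
theorem conj_apply_star_mul {f : B →ₗ[ℂ] ℂ} (hf : ∀ b, 0 ≤ f (star b * b)) (a b : B) :
    star (f (star a * b)) = f (star b * a) := by
  have him : ∀ b, (f (star b * b)).im = 0 := fun b => ((Complex.le_def.1 (hf b)).2).symm
  -- Polarization: the vector `a + b` controls the imaginary parts of the two off-diagonal values,
  -- and `a + i b` their real parts.
  have h1 := him (a + b)
  have h2 := him (a + Complex.I • b)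
  simp only [star_add, star_smul, add_mul, mul_add, map_add, map_smul, smul_mul_assoc,
    mul_smul_comm, smul_eq_mul, Complex.add_im, him, Complex.mul_im, Complex.mul_re,
    Complex.I_re, Complex.I_im, Complex.star_def, Complex.conj_I, Complex.neg_re,
    Complex.neg_im] at h1 h2
  apply Complex.ext
  · simp only [Complex.star_def, Complex.conj_re]; linarith
  · simp only [Complex.star_def, Complex.conj_im]; linarith

set_option linter.unusedVariables false in
/-- The pre-Hilbert space of the GNS construction for a positive functional on a `*`-algebra, a
type synonym of the algebra. -/
@[nolint unusedArguments]
def PreGNS (f : B →ₗ[ℂ] ℂ) (hf : ∀ b, 0 ≤ f (star b * b)) : Type v := B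

namespace PreGNS

variable (f : B →ₗ[ℂ] ℂ) (hf : ∀ b, 0 ≤ f (star b * b))

instance : AddCommGroup (PreGNS f hf) := inferInstanceAs (AddCommGroup B)
instance : Module ℂ (PreGNS f hf) := inferInstanceAs (Module ℂ B)

/-- The semi-inner product `(a, b) ↦ f (a* b)`. -/
abbrev core : PreInnerProductSpace.Core ℂ (PreGNS f hf) where
  inner (a b : B) := f (star a * b)
  conj_inner_symm (a b : B) := conj_apply_star_mul hf b a
  re_inner_nonneg (a : B) := (Complex.le_def.1 (hf a)).1
  add_left (a b c : B) := by
    change f (star (a + b) * c) = f (star a * c) + f (star b * c)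
    rw [star_add, add_mul, map_add]
  smul_left (a b : B) r := by
    change f (star (r • a) * b) = star r * f (star a * b)
    rw [star_smul, smul_mul_assoc, map_smul, smul_eq_mul]

instance : SeminormedAddCommGroup (PreGNS f hf) :=
  InnerProductSpace.Core.toSeminormedAddCommGroup (c := core f hf)
instance : InnerProductSpace ℂ (PreGNS f hf) := InnerProductSpace.ofCore (core f hf)

/-- The class of an element of the algebra in the GNS space. -/
def mk : B ≃ₗ[ℂ] PreGNS f hf := LinearEquiv.refl ℂ B

theorem inner_mk (a b : B) : inner ℂ (mk f hf a) (mk f hf b) = f (star a * b) := rfl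

theorem norm_mk_sq (a : B) : ‖mk f hf a‖ ^ 2 = (f (star a * a)).re := by
  rw [← inner_mk f hf, ← inner_self_eq_norm_sq (𝕜 := ℂ)]
  rfl

/-- The factor `u* u` cancels inside `f ((u b)* (u b))`. Isometries thus act boundedly whatever `f`
is, and an algebra generated by them acts boundedly as a whole. -/
theorem norm_mk_isometry {u : B} (hu : star u * u = 1) (b : B) :
    ‖mk f hf (u * b)‖ = ‖mk f hf b‖ := by
  have h : ‖mk f hf (u * b)‖ ^ 2 = ‖mk f hf b‖ ^ 2 := by
    rw [norm_mk_sq, norm_mk_sq, star_mul, mul_assoc, ← mul_assoc (star u), hu, one_mul]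
  exact (sq_eq_sq₀ (norm_nonneg _) (norm_nonneg _)).1 h

/-- The elements of the algebra that act on the GNS space as bounded operators. -/
def boundedOperators : Subalgebra ℂ B where
  carrier := {a | ∃ C : ℝ, 0 ≤ C ∧ ∀ b, ‖mk f hf (a * b)‖ ≤ C * ‖mk f hf b‖}
  mul_mem' := by
    rintro a b ⟨C, hC0, hC⟩ ⟨D, hD0, hD⟩
    refine ⟨C * D, mul_nonneg hC0 hD0, fun c => ?_⟩
    rw [mul_assoc, mul_assoc]
    exact (hC _).trans (mul_le_mul_of_nonneg_left (hD c) hC0)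
  add_mem' := by
    rintro a b ⟨C, hC0, hC⟩ ⟨D, hD0, hD⟩
    refine ⟨C + D, add_nonneg hC0 hD0, fun c => ?_⟩
    rw [add_mul, map_add, add_mul]
    exact (norm_add_le _ _).trans (add_le_add (hC c) (hD c))
  algebraMap_mem' r := by
    refine ⟨‖r‖, norm_nonneg r, fun c => ?_⟩
    rw [← Algebra.smul_def, map_smul, norm_smul]

variable {f hf}

/-- Left multiplication as a bounded operator on the GNS space. -/
def leftMul (hb : boundedOperators f hf = ⊤) (a : B) : PreGNS f hf →L[ℂ] PreGNS f hf :=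
  LinearMap.mkContinuousOfExistsBound
    ((mk f hf).toLinearMap ∘ₗ LinearMap.mulLeft ℂ a ∘ₗ (mk f hf).symm.toLinearMap) <| by
      have ha : a ∈ boundedOperators f hf := hb ▸ trivial
      obtain ⟨C, -, hC⟩ := ha
      exact ⟨C, hC⟩

theorem leftMul_mk (hb : boundedOperators f hf = ⊤) (a b : B) :
    leftMul hb a (mk f hf b) = mk f hf (a * b) := rfl

/-- The operator seminorm of the GNS representation. -/
def opSeminorm (hb : boundedOperators f hf = ⊤) : Seminorm ℂ B :=
  Seminorm.ofSMulLE (fun a => ‖leftMul hb a‖)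
    (by
      have h : leftMul hb 0 = 0 := by
        ext x
        exact congrArg (mk f hf) (zero_mul ((mk f hf).symm x))
      rw [h]; exact ContinuousLinearMap.opNorm_zero)
    (fun a b => by
      have h : leftMul hb (a + b) = leftMul hb a + leftMul hb b := by
        ext x
        exact congrArg (mk f hf) (add_mul a b ((mk f hf).symm x))
      rw [h]; exact ContinuousLinearMap.opNorm_add_le _ _)
    (fun r a => by
      have h : leftMul hb (r • a) = r • leftMul hb a := by
        ext x
        exact congrArg (mk f hf) (smul_mul_assoc r a ((mk f hf).symm x))
      rw [h]; exact ContinuousLinearMap.opNorm_smul_le _ _)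

/-- Left multiplication by `a*` is a formal adjoint of left multiplication by `a`. With
Cauchy–Schwarz this is enough for the `C*`-identity, so the semi-inner product space need not be
separated or completed. -/
theorem isCStarSeminorm_opSeminorm (hb : boundedOperators f hf = ⊤) :
    IsCStarSeminorm (opSeminorm hb) := by
  have hmul : ∀ a b, ‖leftMul hb (a * b)‖ ≤ ‖leftMul hb a‖ * ‖leftMul hb b‖ := by
    intro a b
    have h : leftMul hb (a * b) = (leftMul hb a).comp (leftMul hb b) := by
      ext x
      exact congrArg (mk f hf) (mul_assoc a b ((mk f hf).symm x))
    rw [h]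
    exact ContinuousLinearMap.opNorm_comp_le _ _
  have hinner : ∀ a b c, inner ℂ (mk f hf (star a * b)) (mk f hf c) =
      inner ℂ (mk f hf b) (mk f hf (a * c)) := by
    intro a b c
    rw [inner_mk, inner_mk, star_mul, star_star, mul_assoc]
  -- Cauchy–Schwarz applied to `‖a b‖² = ⟨a* a b, b⟩`; this is the harder half of the `C*`-identity.
  have hsq : ∀ a b, ‖mk f hf (a * b)‖ ^ 2 ≤ ‖leftMul hb (star a * a)‖ * ‖mk f hf b‖ ^ 2 := by
    intro a b
    have h := hinner a (a * b) b
    rw [← mul_assoc] at h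
    have h2 : ‖mk f hf (a * b)‖ ^ 2 = ‖inner ℂ (mk f hf (star a * a * b)) (mk f hf b)‖ := by
      rw [h, inner_self_eq_norm_sq_to_K]; simp
    rw [h2]
    refine (norm_inner_le_norm _ _).trans ?_
    rw [sq, ← mul_assoc]
    exact mul_le_mul_of_nonneg_right ((leftMul hb (star a * a)).le_opNorm (mk f hf b))
      (norm_nonneg _)
  have hstar : ∀ a, ‖leftMul hb (star a)‖ ≤ ‖leftMul hb a‖ := by
    intro a
    refine ContinuousLinearMap.opNorm_le_bound _ (ContinuousLinearMap.opNorm_nonneg _) fun x => ?_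
    obtain ⟨b, rfl⟩ := (mk f hf).surjective x
    rw [leftMul_mk]
    have h2 : ‖mk f hf (star a * b)‖ ^ 2 =
        ‖inner ℂ (mk f hf b) (mk f hf (a * (star a * b)))‖ := by
      rw [← hinner, inner_self_eq_norm_sq_to_K]; simp
    have h3 : ‖mk f hf (star a * b)‖ ^ 2 ≤
        ‖leftMul hb a‖ * ‖mk f hf b‖ * ‖mk f hf (star a * b)‖ := by
      rw [h2]
      refine (norm_inner_le_norm _ _).trans ?_
      rw [mul_comm ‖leftMul hb a‖, mul_assoc]
      exact mul_le_mul_of_nonneg_left ((leftMul hb a).le_opNorm (mk f hf (star a * b)))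
        (norm_nonneg _)
    -- The bound `h3` is quadratic in `‖a* b‖`; one factor can be cancelled unless it vanishes.
    rcases (norm_nonneg (mk f hf (star a * b))).eq_or_lt with h0 | h0
    · rw [← h0]; positivity
    · nlinarith
  refine ⟨hmul, fun a => le_antisymm ?_ ?_⟩
  · change ‖leftMul hb (star a * a)‖ ≤ ‖leftMul hb a‖ ^ 2
    rw [sq]
    exact (hmul _ _).trans (mul_le_mul_of_nonneg_right (hstar a)
      (ContinuousLinearMap.opNorm_nonneg _))
  · change ‖leftMul hb a‖ ^ 2 ≤ ‖leftMul hb (star a * a)‖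
    refine (Real.le_sqrt (ContinuousLinearMap.opNorm_nonneg _)
      (ContinuousLinearMap.opNorm_nonneg _)).1 ?_
    refine ContinuousLinearMap.opNorm_le_bound _ (Real.sqrt_nonneg _) fun x => ?_
    obtain ⟨b, rfl⟩ := (mk f hf).surjective x
    rw [leftMul_mk, ← Real.sqrt_sq (norm_nonneg (mk f hf b)), ← Real.sqrt_mul (ContinuousLinearMap.opNorm_nonneg _)]
    exact Real.le_sqrt_of_sq_le (hsq a b)

/-- The functional is the vector state of the class of `1`, which is a unit vector because `f 1 =
1`. -/
theorem norm_apply_le_opSeminorm (hb : boundedOperators f hf = ⊤) (h1 : f 1 = 1) (a : B) :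
    ‖f a‖ ≤ opSeminorm hb a := by
  have hone : ‖mk f hf 1‖ = 1 := by
    have h := norm_mk_sq f hf 1
    rw [star_one, one_mul, h1, Complex.one_re] at h
    exact (pow_eq_one_iff_of_nonneg (norm_nonneg _) two_ne_zero).1 h
  have h : f a = inner ℂ (mk f hf 1) (leftMul hb a (mk f hf 1)) := by
    rw [leftMul_mk, inner_mk, star_one, one_mul, mul_one]
  rw [h]
  refine (norm_inner_le_norm _ _).trans ?_
  rw [hone, one_mul]
  have := (leftMul hb a).le_opNorm (mk f hf 1)
  rwa [hone, mul_one] at this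

end PreGNS

end PositiveFunctionals

/-! ### States on the local and the quasi-local algebra -/

section LocalFunctionals

variable {V : Type u} {A : V → Type v} [∀ x, CStarAlgebra (A x)]

theorem elementary_mul (Λ M : Finset V) (a b : Π x, A x) (ha : ∀ x ∉ Λ, a x = 1)
    (hb : ∀ x ∉ M, b x = 1) (N : Finset V) (hab : ∀ x ∉ N, (a * b) x = 1) :
    elementary Λ a ha * elementary M b hb = elementary N (a * b) hab := by
  apply Subtype.ext
  exact PiTensorProduct.tprod_mul_tprod a b

theorem elementary_congr {Λ M : Finset V} {a b : Π x, A x} (h : a = b) (ha : ∀ x ∉ Λ, a x = 1)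
    (hb : ∀ x ∉ M, b x = 1) : elementary Λ a ha = elementary M b hb :=
  Subtype.ext (congrArg (PiTensorProduct.tprod ℂ) h)

theorem elementary_one (Λ : Finset V) (h : ∀ x ∉ Λ, (1 : Π x, A x) x = 1) :
    elementary Λ (1 : Π x, A x) h = 1 := rfl

theorem local_induction {p : LocalAlgebra A → Prop}
    (elem : ∀ (Λ : Finset V) (a : Π x, A x) (ha : ∀ x ∉ Λ, a x = 1), p (elementary Λ a ha))
    (zero : p 0) (add : ∀ s t, p s → p t → p (s + t)) (smul : ∀ (r : ℂ) s, p s → p (r • s))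
    (t : LocalAlgebra A) : p t := by
  obtain ⟨t, ht⟩ := t
  change t ∈ Submodule.span ℂ (localTensors A) at ht
  induction ht using Submodule.span_induction with
  | mem t h => obtain ⟨Λ, a, ha, rfl⟩ := h; exact elem Λ a ha
  | zero => exact zero
  | add s t hs ht h1 h2 => exact add ⟨s, hs⟩ ⟨t, ht⟩ h1 h2
  | smul r t ht h => exact smul r ⟨t, ht⟩ h

theorem update_one_apply_notMem [DecidableEq V] (x : V) (c : A x) :
    ∀ y ∉ ({x} : Finset V), Function.update (1 : Π x, A x) x c y = 1 := by
  intro y hy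
  rw [Function.update_of_ne (by simpa using hy)]; rfl

/-- The local algebra is generated by its unitaries. -/
theorem subalgebra_eq_top_of_unitary_mem (S : Subalgebra ℂ (LocalAlgebra A))
    (hS : ∀ u, star u * u = 1 → u ∈ S) : S = ⊤ := by
  classical
  have single : ∀ (x : V) (c : A x),
      elementary {x} (Function.update (1 : Π x, A x) x c) (update_one_apply_notMem x c) ∈ S := by
    intro x c
    -- A `C*`-algebra is spanned by its unitaries, which gives the one-site observables; the
    -- elementary tensors are finite products of these.
    have hc : c ∈ Submodule.span ℂ (unitary (A x) : Set (A x)) := by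
      rw [CStarAlgebra.span_unitary]; trivial
    induction hc using Submodule.span_induction with
    | mem u hu =>
      refine hS _ (Subtype.ext ?_)
      change star (PiTensorProduct.tprod ℂ (Function.update (1 : Π x, A x) x u)) *
        PiTensorProduct.tprod ℂ (Function.update (1 : Π x, A x) x u) = PiTensorProduct.tprod ℂ 1
      rw [star_tprod, PiTensorProduct.tprod_mul_tprod]
      congr 1
      ext y
      by_cases hy : y = x
      · subst hy; simpa using (Unitary.mem_iff.1 hu).1
      · simp [hy]
    | zero =>
      convert S.zero_mem
      apply Subtype.ext
      exact (PiTensorProduct.tprod ℂ).map_update_zero _ _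
    | add c d _ _ h1 h2 =>
      convert S.add_mem h1 h2
      apply Subtype.ext
      exact (PiTensorProduct.tprod ℂ).map_update_add _ _ _ _
    | smul r c _ h =>
      convert S.smul_mem h r
      apply Subtype.ext
      exact (PiTensorProduct.tprod ℂ).map_update_smul _ _ _ _
  have helem : ∀ (Λ : Finset V) (a : Π x, A x) (ha : ∀ x ∉ Λ, a x = 1),
      elementary Λ a ha ∈ S := by
    intro Λ
    induction Λ using Finset.induction_on with
    | empty =>
      intro a ha
      obtain rfl : a = 1 := by
        ext x
        exact ha x (by simp)
      exact S.one_mem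
    | insert x Λ hx ih =>
      intro a ha
      have h' : ∀ y ∉ Λ, Function.update a x 1 y = 1 := by
        intro y hy
        by_cases hyx : y = x
        · subst hyx; simp
        · rw [Function.update_of_ne hyx]; exact ha y (by simp [hyx, hy])
      have hprod : Function.update (1 : Π x, A x) x (a x) * Function.update a x 1 = a := by
        ext y
        by_cases hyx : y = x
        · subst hyx; simp
        · simp [hyx]
      have := S.mul_mem (single x (a x)) (ih _ h')
      rw [elementary_mul _ _ _ _ _ _ (insert x Λ) (by rwa [hprod])] at this
      rwa [elementary_congr hprod _ ha] at this
  refine eq_top_iff.2 fun t _ => ?_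
  induction t using local_induction with
  | elem Λ a ha => exact helem Λ a ha
  | zero => exact S.zero_mem
  | add s t h1 h2 => exact S.add_mem (h1 trivial) (h2 trivial)
  | smul r t h => exact S.smul_mem (h trivial) r

/-- A positive normalized functional on the local algebra is a contraction. -/
theorem norm_apply_le_of_positive {f : LocalAlgebra A →ₗ[ℂ] ℂ} (hf : ∀ b, 0 ≤ f (star b * b))
    (h1 : f 1 = 1) (a : LocalAlgebra A) : ‖f a‖ ≤ ‖a‖ := by
  have hb : PreGNS.boundedOperators f hf = ⊤ :=
    subalgebra_eq_top_of_unitary_mem _ fun u hu =>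
      ⟨1, zero_le_one, fun b => by rw [PreGNS.norm_mk_isometry f hf hu, one_mul]⟩
  exact (PreGNS.norm_apply_le_opSeminorm hb h1 a).trans
    (le_maxCStarNorm _ (PreGNS.isCStarSeminorm_opSeminorm hb) a)

theorem toQuasi_denseRange : DenseRange (toQuasi : LocalAlgebra A → QuasiLocalAlgebra A) :=
  UniformSpace.Completion.denseRange_coe

/-- A state on a unital `C*`-algebra is continuous. -/
theorem IsState.continuous {B : Type v} [CStarAlgebra B] {ω : B →ₗ[ℂ] ℂ} (hω : IsState ω) :
    Continuous ω := by
  -- In the spectral order the nonnegative elements are exactly the `c* c`, so a state is a positive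
  -- linear map and automatic continuity applies.
  let := CStarAlgebra.spectralOrder B
  have := CStarAlgebra.spectralOrderedRing B
  let p : B →ₚ[ℂ] ℂ := PositiveLinearMap.mk₀ ω fun b hb => by
    obtain ⟨c, rfl⟩ := CStarAlgebra.nonneg_iff_eq_star_mul_self.1 hb
    exact hω.nonneg c
  obtain ⟨C, hC⟩ := p.exists_norm_apply_le
  exact (LinearMap.mkContinuous ω C hC).continuous

theorem IsState.ext_local {ω ω' : QuasiLocalAlgebra A →ₗ[ℂ] ℂ} (hω : IsState ω)
    (hω' : IsState ω') (h : ∀ a : LocalAlgebra A, ω (toQuasi a) = ω' (toQuasi a)) : ω = ω' :=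
  LinearMap.ext fun a => congrFun
    (toQuasi_denseRange.equalizer hω.continuous hω'.continuous (funext h)) a

/-- The constant `1` is common to all states: this equicontinuity is what carries convergence from
local observables to their closure. -/
theorem IsState.norm_apply_le {ω : QuasiLocalAlgebra A →ₗ[ℂ] ℂ} (hω : IsState ω)
    (a : QuasiLocalAlgebra A) : ‖ω a‖ ≤ ‖a‖ := by
  have hc := hω.continuous
  refine UniformSpace.Completion.induction_on a
    (isClosed_le hc.norm continuous_norm) fun a => ?_
  rw [UniformSpace.Completion.norm_coe]
  refine norm_apply_le_of_positive (f := ω ∘ₗ toQuasi.toAlgHom.toLinearMap) (fun b => ?_) ?_ a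
  · change 0 ≤ ω (toQuasi (star b * b))
    rw [map_mul, map_star]
    exact hω.nonneg _
  · change ω (toQuasi 1) = 1
    rw [_root_.map_one (toQuasi (A := A)), hω.map_one]

/-- A positive normalized functional on the local algebra extends to a state. -/
theorem exists_state_extension {f : LocalAlgebra A →ₗ[ℂ] ℂ} (hf : ∀ b, 0 ≤ f (star b * b))
    (h1 : f 1 = 1) :
    ∃ ω : QuasiLocalAlgebra A →ₗ[ℂ] ℂ, IsState ω ∧ ∀ a, ω (toQuasi a) = f a := by
  let F : LocalAlgebra A →L[ℂ] ℂ := f.mkContinuous 1 fun a => by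
    rw [one_mul]; exact norm_apply_le_of_positive hf h1 a
  let ω : QuasiLocalAlgebra A →L[ℂ] ℂ := F.extend UniformSpace.Completion.toComplL
  have hω : ∀ a, ω (toQuasi a) = f a := fun a =>
    F.extend_eq (e := UniformSpace.Completion.toComplL)
      UniformSpace.Completion.denseRange_coe
      (UniformSpace.Completion.isUniformInducing_coe _) a
  refine ⟨ω.toLinearMap, ⟨fun b => ?_, ?_⟩, hω⟩
  -- Positivity is a closed condition on `b`, so it may be checked on the dense local algebra.
  · refine UniformSpace.Completion.induction_on b
      (isClosed_le continuous_const (ω.continuous.comp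
        ((continuous_star_quasi A).mul continuous_id))) fun b => ?_
    have h : ω (toQuasi (star b * b)) = f (star b * b) := hω _
    rw [map_mul, map_star] at h
    change 0 ≤ ω (star (toQuasi b) * toQuasi b)
    rw [h]
    exact hf b
  · change ω 1 = 1
    rw [← map_one (toQuasi (A := A)), hω, h1]

end LocalFunctionals

/-! ### Supports of local observables -/

section Support

variable {V : Type u} {A : V → Type v} [∀ x, CStarAlgebra (A x)]

variable (A) in
/-- The local observables supported on a set of sites: the span of the elementary tensors whose
factors outside the set are `1`. -/
def supportedOn (D : Set V) : Submodule ℂ (LocalAlgebra A) :=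
  Submodule.span ℂ {t | ∃ (Λ : Finset V) (a : Π x, A x) (ha : ∀ x ∉ Λ, a x = 1),
    (∀ x ∉ D, a x = 1) ∧ elementary Λ a ha = t}

theorem elementary_mem_supportedOn {D : Set V} {Λ : Finset V} {a : Π x, A x}
    (ha : ∀ x ∉ Λ, a x = 1) (hD : ∀ x ∉ D, a x = 1) : elementary Λ a ha ∈ supportedOn A D :=
  Submodule.subset_span ⟨Λ, a, ha, hD, rfl⟩

theorem supportedOn_mono {D D' : Set V} (h : D ⊆ D') : supportedOn A D ≤ supportedOn A D' := by
  refine Submodule.span_mono ?_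
  rintro _ ⟨Λ, a, ha, hD, rfl⟩
  exact ⟨Λ, a, ha, fun x hx => hD x fun hx' => hx (h hx'), rfl⟩

theorem supportedOn_induction {D : Set V} {p : ∀ t, t ∈ supportedOn A D → Prop}
    (elem : ∀ (Λ : Finset V) (a : Π x, A x) (ha : ∀ x ∉ Λ, a x = 1) (hD : ∀ x ∉ D, a x = 1),
      p (elementary Λ a ha) (elementary_mem_supportedOn ha hD))
    (zero : p 0 (Submodule.zero_mem _))
    (add : ∀ s t hs ht, p s hs → p t ht → p (s + t) (Submodule.add_mem _ hs ht))
    (smul : ∀ (r : ℂ) s hs, p s hs → p (r • s) (Submodule.smul_mem _ r hs))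
    {t : LocalAlgebra A} (ht : t ∈ supportedOn A D) : p t ht := by
  induction ht using Submodule.span_induction with
  | mem t h => obtain ⟨Λ, a, ha, hD, rfl⟩ := h; exact elem Λ a ha hD
  | zero => exact zero
  | add s t hs ht h1 h2 => exact add s t hs ht h1 h2
  | smul r t ht h => exact smul r t ht h

theorem exists_finset_mem_supportedOn (t : LocalAlgebra A) :
    ∃ Λ : Finset V, t ∈ supportedOn A (Λ : Set V) := by
  classical
  induction t using local_induction with
  | elem Λ a ha => exact ⟨Λ, elementary_mem_supportedOn ha ha⟩
  | zero => exact ⟨∅, Submodule.zero_mem _⟩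
  | add s t h1 h2 =>
    obtain ⟨Λ, h1⟩ := h1
    obtain ⟨M, h2⟩ := h2
    exact ⟨Λ ∪ M, Submodule.add_mem _
      (supportedOn_mono (by exact_mod_cast Finset.subset_union_left) h1)
      (supportedOn_mono (by exact_mod_cast Finset.subset_union_right) h2)⟩
  | smul r t h => exact h.imp fun Λ h => Submodule.smul_mem _ r h

theorem exists_elementary_mul_eq {Λ M : Finset V} {a b : Π x, A x} (ha : ∀ x ∉ Λ, a x = 1)
    (hb : ∀ x ∉ M, b x = 1) : ∃ (N : Finset V) (hab : ∀ x ∉ N, (a * b) x = 1),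
      elementary Λ a ha * elementary M b hb = elementary N (a * b) hab := by
  classical
  have hab : ∀ x ∉ Λ ∪ M, (a * b) x = 1 := by
    intro x hx
    rw [Finset.mem_union, not_or] at hx
    simp [ha x hx.1, hb x hx.2]
  exact ⟨_, hab, elementary_mul _ _ _ _ _ _ _ hab⟩

theorem supportedOn_mul_mem {D : Set V} {s t : LocalAlgebra A} (hs : s ∈ supportedOn A D)
    (ht : t ∈ supportedOn A D) : s * t ∈ supportedOn A D := by
  induction hs using supportedOn_induction with
  | elem Λ a ha haD =>
    induction ht using supportedOn_induction with
    | elem M b hb hbD =>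
      obtain ⟨N, hab, h⟩ := exists_elementary_mul_eq ha hb
      rw [h]
      exact elementary_mem_supportedOn hab fun x hx => by simp [haD x hx, hbD x hx]
    | zero => rw [mul_zero]; exact Submodule.zero_mem _
    | add s t _ _ h1 h2 => rw [mul_add]; exact Submodule.add_mem _ h1 h2
    | smul r s _ h => rw [mul_smul_comm]; exact Submodule.smul_mem _ r h
  | zero => rw [zero_mul]; exact Submodule.zero_mem _
  | add s t _ _ h1 h2 => rw [add_mul]; exact Submodule.add_mem _ h1 h2
  | smul r s _ h => rw [smul_mul_assoc]; exact Submodule.smul_mem _ r h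

theorem star_elementary {Λ : Finset V} {a : Π x, A x} (ha : ∀ x ∉ Λ, a x = 1) :
    star (elementary Λ a ha) = elementary Λ (star a) fun x hx => by simp [ha x hx] :=
  Subtype.ext (star_tprod A a)

theorem supportedOn_star_mem {D : Set V} {s : LocalAlgebra A} (hs : s ∈ supportedOn A D) :
    star s ∈ supportedOn A D := by
  induction hs using supportedOn_induction with
  | elem Λ a ha haD =>
    rw [star_elementary]
    exact elementary_mem_supportedOn _ fun x hx => by simp [haD x hx]
  | zero => rw [star_zero]; exact Submodule.zero_mem _
  | add s t _ _ h1 h2 => rw [star_add]; exact Submodule.add_mem _ h1 h2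
  | smul r s _ h => rw [star_smul]; exact Submodule.smul_mem _ _ h

/-- Observables with disjoint supports commute. -/
theorem commute_of_disjoint {D D' : Set V} (hDD' : Disjoint D D') {s t : LocalAlgebra A}
    (hs : s ∈ supportedOn A D) (ht : t ∈ supportedOn A D') : s * t = t * s := by
  induction hs using supportedOn_induction with
  | elem Λ a ha haD =>
    induction ht using supportedOn_induction with
    | elem M b hb hbD =>
      refine Subtype.ext ?_
      change PiTensorProduct.tprod ℂ a * PiTensorProduct.tprod ℂ b =
        PiTensorProduct.tprod ℂ b * PiTensorProduct.tprod ℂ a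
      rw [PiTensorProduct.tprod_mul_tprod, PiTensorProduct.tprod_mul_tprod]
      congr 1
      ext x
      by_cases hx : x ∈ D
      · simp [hbD x (Set.disjoint_left.1 hDD' hx)]
      · simp [haD x hx]
    | zero => rw [mul_zero, zero_mul]
    | add s t _ _ h1 h2 => rw [mul_add, add_mul, h1, h2]
    | smul r s _ h => rw [mul_smul_comm, smul_mul_assoc, h]
  | zero => rw [mul_zero, zero_mul]
  | add s t _ _ h1 h2 => rw [mul_add, add_mul, h1, h2]
  | smul r s _ h => rw [mul_smul_comm, smul_mul_assoc, h]

/-- A product state factorizes over disjoint supports. -/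
theorem IsProductState.apply_mul_of_disjoint {φ₀ : QuasiLocalAlgebra A →ₗ[ℂ] ℂ}
    {φ : ∀ x, A x →ₗ[ℂ] ℂ} (hφ : IsProductState φ₀ φ) {D D' : Set V} (hDD' : Disjoint D D')
    {s t : LocalAlgebra A} (hs : s ∈ supportedOn A D) (ht : t ∈ supportedOn A D') :
    φ₀ (toQuasi (s * t)) = φ₀ (toQuasi s) * φ₀ (toQuasi t) := by
  classical
  induction hs using supportedOn_induction with
  | elem Λ a ha haD =>
    induction ht using supportedOn_induction with
    | elem M b hb hbD =>
      have ha' : ∀ x ∉ Λ ∪ M, a x = 1 := fun x hx => ha x fun h => hx (by simp [h])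
      have hb' : ∀ x ∉ Λ ∪ M, b x = 1 := fun x hx => hb x fun h => hx (by simp [h])
      have hab : ∀ x ∉ Λ ∪ M, (a * b) x = 1 := fun x hx => by simp [ha' x hx, hb' x hx]
      rw [elementary_mul _ _ _ _ _ _ _ hab, elementary_congr rfl ha ha',
        elementary_congr rfl hb hb', hφ.apply_elementary, hφ.apply_elementary,
        hφ.apply_elementary, ← Finset.prod_mul_distrib]
      -- At each site at least one of the two factors is `1`, so the one-site state is
      -- multiplicative on this pair.
      refine Finset.prod_congr rfl fun x _ => ?_
      by_cases hx : x ∈ D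
      · simp [hbD x (Set.disjoint_left.1 hDD' hx), (hφ.isState_site x).map_one]
      · simp [haD x hx, (hφ.isState_site x).map_one]
    | zero => simp
    | add s t _ _ h1 h2 => simp only [mul_add, map_add, h1, h2]
    | smul r s _ h => simp only [mul_smul_comm, map_smul, h, smul_eq_mul]; ring
  | zero => simp
  | add s t _ _ h1 h2 => simp only [add_mul, map_add, h1, h2]
  | smul r s _ h => simp only [smul_mul_assoc, map_smul, h, smul_eq_mul]; ring

end Support

/-! ### Tensors over finite regions inside the local algebra -/

section Regions

variable {V : Type u} {A : V → Type v} [∀ x, CStarAlgebra (A x)]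

open Classical in
/-- The extension by `1` of a family over a finite region to a family over all sites. -/
def extendGlobal (Λ : Finset V) (b : Π x : Λ, A x) : Π x, A x :=
  fun x => if hx : x ∈ Λ then b ⟨x, hx⟩ else 1

theorem extendGlobal_of_mem {Λ : Finset V} (b : Π x : Λ, A x) {x : V} (hx : x ∈ Λ) :
    extendGlobal Λ b x = b ⟨x, hx⟩ := by simp [extendGlobal, hx]

theorem extendGlobal_of_notMem {Λ : Finset V} (b : Π x : Λ, A x) (x : V) (hx : x ∉ Λ) :
    extendGlobal Λ b x = 1 := by simp [extendGlobal, hx]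

theorem regionToLocal_tprod (Λ : Finset V) (b : Π x : Λ, A x) :
    regionToLocal Λ (PiTensorProduct.tprod ℂ b) =
      elementary Λ (extendGlobal Λ b) (extendGlobal_of_notMem b) := by
  apply Subtype.ext
  exact PiTensorProduct.lift.tprod b

theorem regionToLocal_mem (Λ : Finset V) (s : RegionAlgebra A Λ) :
    regionToLocal Λ s ∈ supportedOn A (Λ : Set V) := by
  induction s using PiTensorProduct.induction_on with
  | smul_tprod r b =>
    rw [map_smul, regionToLocal_tprod]
    exact Submodule.smul_mem _ r (elementary_mem_supportedOn _ (extendGlobal_of_notMem b))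
  | add s t h1 h2 => rw [map_add]; exact Submodule.add_mem _ h1 h2

theorem regionToLocal_one (Λ : Finset V) : regionToLocal Λ (1 : RegionAlgebra A Λ) = 1 := by
  rw [PiTensorProduct.one_def, regionToLocal_tprod]
  refine (elementary_congr ?_ _ fun _ _ => rfl).trans (elementary_one Λ fun _ _ => rfl)
  ext x
  by_cases hx : x ∈ Λ
  · rw [extendGlobal_of_mem _ hx]; rfl
  · rw [extendGlobal_of_notMem _ x hx]

theorem regionToLocal_mul (Λ : Finset V) (s t : RegionAlgebra A Λ) :
    regionToLocal Λ (s * t) = regionToLocal Λ s * regionToLocal Λ t := by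
  induction s using PiTensorProduct.induction_on with
  | smul_tprod r b =>
    induction t using PiTensorProduct.induction_on with
    | smul_tprod r' b' =>
      rw [smul_mul_smul_comm, PiTensorProduct.tprod_mul_tprod, map_smul, map_smul, map_smul,
        smul_mul_smul_comm]
      congr 1
      have h : extendGlobal Λ b * extendGlobal Λ b' = extendGlobal Λ (b * b') := by
        ext x
        by_cases hx : x ∈ Λ
        · simp [extendGlobal, hx]
        · simp [extendGlobal, hx]
      rw [regionToLocal_tprod, regionToLocal_tprod, regionToLocal_tprod,
        elementary_mul _ _ _ _ _ _ Λ (by rw [h]; exact extendGlobal_of_notMem _)]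
      exact elementary_congr h.symm _ _
    | add s t h1 h2 => rw [mul_add, map_add, map_add, mul_add, h1, h2]
  | add s t h1 h2 => rw [add_mul, map_add, map_add, add_mul, h1, h2]

theorem regionToLocal_star (Λ : Finset V) (s : RegionAlgebra A Λ) :
    regionToLocal Λ (star s) = star (regionToLocal Λ s) := by
  induction s using PiTensorProduct.induction_on with
  | smul_tprod r b =>
    rw [star_smul, star_tprod, map_smul, map_smul, star_smul, regionToLocal_tprod,
      regionToLocal_tprod, star_elementary]
    congr 1
    refine elementary_congr ?_ _ _
    ext x
    by_cases hx : x ∈ Λ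
    · simp [extendGlobal, hx]
    · simp [extendGlobal, hx]
  | add s t h1 h2 => rw [star_add, map_add, map_add, star_add, h1, h2]

theorem offPart_of_notMem {Λ N : Finset V} {a : Π x, A x} (ha : ∀ x ∉ N, a x = 1) :
    ∀ x ∉ N, offPart Λ a x = 1 := fun x hx => by simp [offPart, ha x hx]

theorem offPart_mem_supportedOn {Λ N : Finset V} {D : Set V} {a : Π x, A x}
    (ha : ∀ x ∉ N, a x = 1) (hD : ∀ x ∉ D, a x = 1) :
    elementary N (offPart Λ a) (offPart_of_notMem ha) ∈ supportedOn A (D \ Λ) := by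
  refine elementary_mem_supportedOn _ fun x hx => ?_
  by_cases hxΛ : x ∈ Λ
  · simp [offPart, hxΛ]
  · simp [offPart, hD x fun h => hx ⟨h, hxΛ⟩]

/-- An elementary tensor is the product of its restriction to `P` and its part off `Λ`, if its
factors on `Λ \ P` are trivial. -/
theorem elementary_eq_mul {P Λ N : Finset V} (hP : P ⊆ Λ) {a : Π x, A x}
    (ha : ∀ x ∉ N, a x = 1) (hΛ : ∀ x ∈ Λ, x ∉ P → a x = 1) :
    elementary N a ha = regionToLocal P (PiTensorProduct.tprod ℂ fun x : P => a x) *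
      elementary N (offPart Λ a) (offPart_of_notMem ha) := by
  have h : extendGlobal P (fun x : P => a x) * offPart Λ a = a := by
    ext x
    by_cases hx : x ∈ P
    · simp [extendGlobal, offPart, hx, hP hx]
    · by_cases hx' : x ∈ Λ
      · simp [extendGlobal, offPart, hx, hx', hΛ x hx' hx]
      · simp [extendGlobal, offPart, hx, hx']
  rw [regionToLocal_tprod, elementary_mul _ _ _ _ _ _ N (by rwa [h])]
  exact elementary_congr h.symm _ _

theorem regionInclusion_tprod_restrict {P Λ : Finset V} (hP : P ⊆ Λ) {a : Π x, A x}
    (hΛ : ∀ x ∈ Λ, x ∉ P → a x = 1) :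
    regionInclusion hP (PiTensorProduct.tprod ℂ fun x : P => a x) =
      PiTensorProduct.tprod ℂ fun x : Λ => a x := by
  refine (PiTensorProduct.lift.tprod _).trans ?_
  change PiTensorProduct.tprod ℂ (extendByOne P Λ fun x : P => a x) = _
  congr 1
  ext x
  by_cases hx : x.1 ∈ P
  · simp [extendByOne, hx]
  · simp [extendByOne, hx, hΛ x x.2 hx]

end Regions

/-! ### Ampliations of transition expectations -/

section Ampliation

variable {V : Type u} {A : V → Type v} [∀ x, CStarAlgebra (A x)] {Λ M : Finset V}
  (E : RegionAlgebra A Λ →ₗ[ℂ] RegionAlgebra A M)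

theorem ampliation_elementary {N : Finset V} {a : Π x, A x} (ha : ∀ x ∉ N, a x = 1) :
    ampliation E (elementary N a ha) =
      regionToLocal M (E (PiTensorProduct.tprod ℂ fun x : Λ => a x)) *
        elementary N (offPart Λ a) (offPart_of_notMem ha) := by
  apply Subtype.ext
  exact PiTensorProduct.lift.tprod a

/-- This characterizes `E ⊗ id` without reference to elementary tensors: it is linear over the
observables outside `Λ`. The positivity argument uses only this form. -/
theorem ampliation_regionToLocal_mul (s : RegionAlgebra A Λ) {c : LocalAlgebra A}
    (hc : c ∈ supportedOn A (Λ : Set V)ᶜ) :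
    ampliation E (regionToLocal Λ s * c) = regionToLocal M (E s) * c := by
  induction hc using supportedOn_induction with
  | elem N c hc hcΛ =>
    induction s using PiTensorProduct.induction_on with
    | smul_tprod r b =>
      rw [map_smul, smul_mul_assoc, map_smul, map_smul, map_smul, smul_mul_assoc]
      congr 1
      rw [regionToLocal_tprod]
      obtain ⟨N', h', h⟩ := exists_elementary_mul_eq (extendGlobal_of_notMem b) hc
      have hcΛ' : ∀ x ∈ Λ, c x = 1 := fun x hx => hcΛ x fun h => h hx
      rw [h, ampliation_elementary]
      congr 1
      · congr 3
        ext x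
        simp [extendGlobal, hcΛ' x x.2]
      · refine elementary_congr ?_ _ _
        ext x
        by_cases hx : x ∈ Λ
        · simp [offPart, hx, hcΛ' x hx]
        · simp [offPart, extendGlobal, hx]
    | add s t h1 h2 => simp only [map_add, add_mul, h1, h2]
  | zero => simp
  | add s t _ _ h1 h2 => simp only [map_add, mul_add, h1, h2]
  | smul r s _ h => simp only [mul_smul_comm, map_smul, h]

theorem ampliation_mem_supportedOn {D : Set V} {t : LocalAlgebra A} (ht : t ∈ supportedOn A D) :
    ampliation E t ∈ supportedOn A ((D \ Λ) ∪ M) := by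
  induction ht using supportedOn_induction with
  | elem N a ha haD =>
    rw [ampliation_elementary]
    exact supportedOn_mul_mem
      (supportedOn_mono Set.subset_union_right (regionToLocal_mem M _))
      (supportedOn_mono Set.subset_union_left (offPart_mem_supportedOn ha haD))
  | zero => rw [map_zero]; exact Submodule.zero_mem _
  | add s t _ _ h1 h2 => rw [map_add]; exact Submodule.add_mem _ h1 h2
  | smul r s _ h => rw [map_smul]; exact Submodule.smul_mem _ r h

variable {E} in
theorem ampliation_one (hE : IsTransitionExpectation E) : ampliation E 1 = 1 := by
  have h := ampliation_regionToLocal_mul E 1 (c := 1)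
    (elementary_mem_supportedOn (Λ := ∅) (a := 1) (fun _ _ => rfl) fun _ _ => rfl)
  rwa [hE.map_one, regionToLocal_one, regionToLocal_one, one_mul] at h

/-- The ampliation of a map that is compatible with a product state on `𝒜_P` preserves the state on
the observables whose support meets `Λ` only in `P`. -/
theorem IsProductState.apply_ampliation {φ₀ : QuasiLocalAlgebra A →ₗ[ℂ] ℂ}
    {φ : ∀ x, A x →ₗ[ℂ] ℂ} (hφ : IsProductState φ₀ φ) {P : Finset V} (hP : P ⊆ Λ) (hM : M ⊆ Λ)
    (hcompat : ∀ s, restrictState φ₀ M (E (regionInclusion hP s)) = restrictState φ₀ P s)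
    {D : Set V} (hD : ∀ x ∈ Λ, x ∈ D → x ∈ P) {t : LocalAlgebra A} (ht : t ∈ supportedOn A D) :
    φ₀ (toQuasi (ampliation E t)) = φ₀ (toQuasi t) := by
  induction ht using supportedOn_induction with
  | elem N a ha haD =>
    have hΛ : ∀ x ∈ Λ, x ∉ P → a x = 1 := fun x hx hxP => haD x fun h => hxP (hD x hx h)
    have hoff := offPart_mem_supportedOn (Λ := Λ) ha haD
    -- The part off `Λ` is independent of both `𝒜_P` and `𝒜_M`, so it splits off as the same scalar
    -- before and after `E`, and compatibility compares the other factors.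
    have hdisj : ∀ Q : Finset V, Q ⊆ Λ → Disjoint (Q : Set V) (D \ Λ) := fun Q hQ =>
      Set.disjoint_left.2 fun x hx hx' => hx'.2 (hQ hx)
    rw [ampliation_elementary, elementary_eq_mul hP ha hΛ,
      hφ.apply_mul_of_disjoint (hdisj M hM) (regionToLocal_mem M _) hoff,
      hφ.apply_mul_of_disjoint (hdisj P hP) (regionToLocal_mem P _) hoff,
      ← regionInclusion_tprod_restrict hP hΛ]
    exact congrArg (· * _) (hcompat _)
  | zero => simp
  | add s t _ _ h1 h2 => simp only [map_add, h1, h2]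
  | smul r s _ h => simp only [map_smul, h]

/-- The algebraic splitting of the local algebra into `𝒜_Λ` and the observables outside `Λ`. The
number of summands is the matrix size at which complete positivity is invoked. -/
theorem exists_sum_regionToLocal_mul (Λ : Finset V) (t : LocalAlgebra A) :
    ∃ (k : ℕ) (p : Fin k → RegionAlgebra A Λ) (c : Fin k → LocalAlgebra A),
      (∀ i, c i ∈ supportedOn A (Λ : Set V)ᶜ) ∧ t = ∑ i, regionToLocal Λ (p i) * c i := by
  induction t using local_induction with
  | elem N a ha =>
    refine ⟨1, fun _ => PiTensorProduct.tprod ℂ fun x : Λ => a x,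
      fun _ => elementary N (offPart Λ a) (offPart_of_notMem ha), fun _ => ?_, ?_⟩
    · exact supportedOn_mono (fun x hx => hx.2)
        (offPart_mem_supportedOn (D := Set.univ) ha fun x hx => absurd trivial hx)
    · rw [Fin.sum_univ_one]
      exact elementary_eq_mul subset_rfl ha fun x hx hx' => absurd hx hx'
  | zero => exact ⟨0, 0, 0, fun i => i.elim0, by simp⟩
  | add s t h1 h2 =>
    obtain ⟨k, p, c, hc, rfl⟩ := h1
    obtain ⟨l, q, d, hd, rfl⟩ := h2
    refine ⟨k + l, Fin.append p q, Fin.append c d, fun i => ?_, ?_⟩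
    · refine Fin.addCases (fun i => ?_) (fun i => ?_) i
      · rw [Fin.append_left]; exact hc i
      · rw [Fin.append_right]; exact hd i
    · simp [Fin.sum_univ_add]
  | smul r t h =>
    obtain ⟨k, p, c, hc, rfl⟩ := h
    exact ⟨k, r • p, c, hc, by simp [Finset.smul_sum]⟩

/-- The cone of finite sums of elements of the form `b* b`. -/
def sumsOfSquares (B : Type v) [Ring B] [StarRing B] : AddSubmonoid B :=
  AddSubmonoid.closure {t | ∃ b, star b * b = t}

theorem nonneg_apply_of_mem_sumsOfSquares {B : Type v} [Ring B] [StarRing B] [Algebra ℂ B]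
    {f : B →ₗ[ℂ] ℂ} (hf : ∀ b, 0 ≤ f (star b * b)) {t : B} (ht : t ∈ sumsOfSquares B) :
    0 ≤ f t := by
  induction ht using AddSubmonoid.closure_induction with
  | mem t h => obtain ⟨b, rfl⟩ := h; exact hf b
  | zero => rw [map_zero]
  | add s t _ _ h1 h2 => rw [map_add]; exact add_nonneg h1 h2

variable {E} in
/-- The ampliation of a completely positive map `𝒜_Λ → 𝒜_M` with `M ⊆ Λ` is positive. -/
theorem ampliation_star_mul_self_mem (hE : IsTransitionExpectation E) (hM : M ⊆ Λ)
    (b : LocalAlgebra A) : ampliation E (star b * b) ∈ sumsOfSquares (LocalAlgebra A) := by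
  obtain ⟨k, p, c, hc, rfl⟩ := exists_sum_regionToLocal_mul Λ b
  have hdisj : Disjoint (Λ : Set V) (Λ : Set V)ᶜ := disjoint_compl_right
  have hdisj' : Disjoint (M : Set V) (Λ : Set V)ᶜ :=
    Set.disjoint_left.2 fun x hx hx' => hx' (hM hx)
  -- An empty sum is treated apart, since the matrix below needs a row of index `0`.
  cases k with
  | zero => simp
  | succ k =>
    -- With first row `p` and all other rows zero, the entries of `Mᴴ M` are `p i* p j`.
    obtain ⟨N, hN⟩ := hE.completelyPositive (k + 1) (Matrix.of fun i j => if i = 0 then p j else 0)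
    have hN' : ∀ i j, E (star (p i) * p j) = ∑ l, star (N l i) * N l j := by
      intro i j
      have h := congrFun (congrFun hN i) j
      rw [Matrix.map_apply, Matrix.mul_apply, Matrix.mul_apply,
        Finset.sum_eq_single 0 (fun l _ hl => by simp [hl]) (by simp)] at h
      simpa only [Matrix.conjTranspose_apply, Matrix.of_apply, if_true] using h
    have hswap : ∀ {Q : Finset V}, Disjoint (Q : Set V) (Λ : Set V)ᶜ →
        ∀ (s t : RegionAlgebra A Q) (i j : Fin (k + 1)),
          star (regionToLocal Q s * c i) * (regionToLocal Q t * c j) =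
            regionToLocal Q (star s * t) * (star (c i) * c j) := by
      intro Q hQ s t i j
      rw [star_mul, mul_assoc, ← mul_assoc (star (regionToLocal Q s)), ← regionToLocal_star,
        ← regionToLocal_mul, ← mul_assoc, ← commute_of_disjoint hQ (regionToLocal_mem Q _)
          (supportedOn_star_mem (hc i)), mul_assoc]
    -- With `E (p i* p j) = ∑ l, (N l i)* N l j`, the image of `b* b` regroups into one square for
    -- each row `l` of `N`. The regrouping uses `M ⊆ Λ`, by which the entries of `N` commute with
    -- the `c i`.
    have hsum : ampliation E (star (∑ i, regionToLocal Λ (p i) * c i) *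
          ∑ i, regionToLocal Λ (p i) * c i) =
        ∑ l, star (∑ i, regionToLocal M (N l i) * c i) * ∑ i, regionToLocal M (N l i) * c i := by
      simp only [star_sum, Finset.sum_mul_sum, hswap hdisj, hswap hdisj', map_sum]
      rw [Finset.sum_comm]
      conv_rhs => rw [Finset.sum_comm]
      rw [Finset.sum_comm]
      refine Finset.sum_congr rfl fun i _ => ?_
      rw [Finset.sum_comm]
      refine Finset.sum_congr rfl fun j _ => ?_
      rw [ampliation_regionToLocal_mul E _
        (supportedOn_mul_mem (supportedOn_star_mem (hc i)) (hc j)), hN', map_sum,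
        Finset.sum_mul]
    rw [hsum]
    exact AddSubmonoid.sum_mem _ fun l _ => AddSubmonoid.subset_closure ⟨_, rfl⟩

-- Positivity is followed through compositions as membership in this cone: the image of a square is
-- only a sum of squares, so single squares would not iterate.
variable {E} in
theorem ampliation_mem_sumsOfSquares (hE : IsTransitionExpectation E) (hM : M ⊆ Λ)
    {t : LocalAlgebra A} (ht : t ∈ sumsOfSquares (LocalAlgebra A)) :
    ampliation E t ∈ sumsOfSquares (LocalAlgebra A) := by
  induction ht using AddSubmonoid.closure_induction with
  | mem t h => obtain ⟨b, rfl⟩ := h; exact ampliation_star_mul_self_mem hE hM b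
  | zero => rw [map_zero]; exact AddSubmonoid.zero_mem _
  | add s t _ _ h1 h2 => rw [map_add]; exact AddSubmonoid.add_mem _ h1 h2

end Ampliation

/-! ### Geometry of the tessellation -/

section Tessellation

variable {V : Type u} {G : SimpleGraph V} {o : V}

theorem plaquettes_mono {S T : Set V} (h : S ⊆ T) : plaquettes G S ⊆ plaquettes G T :=
  Set.biUnion_subset_biUnion_left h

theorem subset_plaquettes (S : Set V) : S ⊆ plaquettes G S := fun x hx =>
  Set.mem_biUnion hx (Set.mem_insert x _)

theorem centers_subset_succ (n : ℕ) : centers G o n ⊆ centers G o (n + 1) := by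
  cases n with
  | zero => exact Set.empty_subset _
  | succ n => exact Set.subset_union_left

theorem ball_mono : Monotone (ball G o) :=
  monotone_nat_of_le_succ fun n => plaquettes_mono (centers_subset_succ n)

theorem level_subset_centers (n : ℕ) : level G o n ⊆ centers G o (n + 1) := by
  cases n with
  | zero => exact subset_rfl
  | succ n => exact Set.subset_union_right

theorem level_subset_ball (n : ℕ) : level G o n ⊆ ball G o (n + 1) :=
  (level_subset_centers n).trans (subset_plaquettes _)

theorem level_subset_allCenters (n : ℕ) : level G o n ⊆ allCenters G o := fun _ hy =>
  Set.mem_biUnion (Nat.succ_pos n) (level_subset_centers n hy)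

/-- Induction along a walk to the root: a neighbor of a ball is inside it or on its external
boundary, which the next ball contains. -/
theorem exists_mem_ball (hconn : G.Connected) (x : V) : ∃ n, x ∈ ball G o n := by
  obtain ⟨w⟩ := hconn.preconnected x o
  induction w with
  | nil => exact ⟨1, level_subset_ball 0 rfl⟩
  | @cons x y o hxy _ ih =>
    obtain ⟨n, hn⟩ := ih
    have hn' := ball_mono n.le_succ hn
    by_cases hx : x ∈ ball G o (n + 1)
    · exact ⟨_, hx⟩
    · exact ⟨n + 2, level_subset_ball (n + 1) ⟨hx, y, hn', hxy.symm⟩⟩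

theorem exists_subset_ball (hconn : G.Connected) (Λ : Finset V) :
    ∃ n, (Λ : Set V) ⊆ ball G o n := by
  choose N hN using exists_mem_ball (G := G) (o := o) hconn
  exact ⟨Λ.sup N, fun x hx => ball_mono (Finset.le_sup (f := N) hx) (hN x)⟩

variable [G.LocallyFinite]

theorem mem_succ {n : ℕ} {x y : V} :
    x ∈ succ G o n y ↔ G.Adj y x ∧ x ∈ internalBoundary G (ball G o (n + 1)) := by
  simp [succ]

theorem succ_subset_ball (n : ℕ) (y : V) : (succ G o n y : Set V) ⊆ ball G o (n + 1) :=
  fun _ hx => (mem_succ.1 hx).2.1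

theorem succ_subset_plaquette (n : ℕ) (y : V) : succ G o n y ⊆ plaquette G y := by
  classical
  exact (Finset.filter_subset _ _).trans (Finset.subset_insert _ _)

/-- A successor has a neighbor outside `V_{n+2}`, whereas all neighbors of a point of `V_{n+1}` lie
in `V_{n+2}`. -/
theorem disjoint_succ_ball (n : ℕ) (y : V) :
    Disjoint (succ G o (n + 1) y : Set V) (ball G o (n + 1)) := by
  rw [Set.disjoint_left]
  intro x hx hxn
  obtain ⟨-, w, hw, hxw⟩ := (mem_succ.1 hx).2
  have hw' : w ∉ ball G o (n + 1) := fun h => hw (ball_mono (n + 1).le_succ h)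
  exact hw (level_subset_ball (n + 1) ⟨hw', x, hxn, hxw⟩)

theorem mem_prev_of_mem_plaquette {n : ℕ} {y x : V} (hrest : rest G o n y = ∅)
    (hx : x ∈ plaquette G y) (hxy : x ≠ y) (hxs : x ∉ succ G o n y) : x ∈ prev G o n y := by
  classical
  have hx' : x ∈ G.neighborFinset y := by
    simp only [plaquette, Finset.mem_insert] at hx
    exact hx.resolve_left hxy
  rw [rest, Finset.sdiff_eq_empty_iff_subset] at hrest
  exact (Finset.mem_union.1 (hrest hx')).resolve_right hxs

theorem notMem_succ_of_mem_level
    (hbip : ∀ x y, G.Adj x y → (x ∈ allCenters G o ↔ y ∉ allCenters G o)) {n : ℕ} {y z : V}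
    (hy : y ∈ level G o n) (hz : z ∈ level G o n) : z ∉ succ G o n y := fun h =>
  (hbip y z (mem_succ.1 h).1).1 (level_subset_allCenters n hy) (level_subset_allCenters n hz)

end Tessellation

/-! ### Composition of the transition expectations along the levels -/

section ForwardMaps

variable {V : Type u} {G : SimpleGraph V} [G.LocallyFinite] {o : V} {A : V → Type v}
  [∀ x, CStarAlgebra (A x)] {E : TransitionFamily G o A}

theorem levelMap_one {n : ℕ} {l : List V} (hE : ∀ y ∈ l, IsTransitionExpectation (E n y)) :
    levelMap E n l 1 = 1 := by
  induction l with
  | nil => rfl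
  | cons y l ih =>
    rw [levelMap, LinearMap.comp_apply, ampliation_one (hE y List.mem_cons_self)]
    exact ih fun z hz => hE z (List.mem_cons_of_mem _ hz)

theorem levelMap_mem_sumsOfSquares {n : ℕ} {l : List V}
    (hE : ∀ y ∈ l, IsTransitionExpectation (E n y)) {t : LocalAlgebra A}
    (ht : t ∈ sumsOfSquares (LocalAlgebra A)) :
    levelMap E n l t ∈ sumsOfSquares (LocalAlgebra A) := by
  induction l generalizing t with
  | nil => exact ht
  | cons y l ih =>
    exact ih (fun z hz => hE z (List.mem_cons_of_mem _ hz))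
      (ampliation_mem_sumsOfSquares (hE y List.mem_cons_self) (succ_subset_plaquette n y) ht)

theorem levelMap_mem_supportedOn {n : ℕ} {D : Set V} (hD : ball G o (n + 1) ⊆ D) (l : List V)
    {t : LocalAlgebra A} (ht : t ∈ supportedOn A D) : levelMap E n l t ∈ supportedOn A D := by
  induction l generalizing t with
  | nil => exact ht
  | cons y l ih =>
    exact ih (supportedOn_mono (Set.union_subset Set.sdiff_subset
      ((succ_subset_ball n y).trans hD)) (ampliation_mem_supportedOn (E n y) ht))

/-- A level of transition expectations that are compatible with a product state preserves this
state on the observables supported away from the level and its successors. -/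
theorem IsProductState.apply_levelMap {φ₀ : QuasiLocalAlgebra A →ₗ[ℂ] ℂ} {φ : ∀ x, A x →ₗ[ℂ] ℂ}
    (hφ : IsProductState φ₀ φ)
    (hbip : ∀ x y, G.Adj x y → (x ∈ allCenters G o ↔ y ∉ allCenters G o)) {n : ℕ}
    (hrest : ∀ y ∈ level G o n, rest G o n y = ∅)
    (hsucc : ∀ y ∈ level G o n, ∀ z ∈ level G o n, y ≠ z →
      Disjoint (succ G o n y) (succ G o n z))
    (hcompat : ∀ y ∈ level G o n, ∀ a : RegionAlgebra A (prev G o n y),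
      restrictState φ₀ (succ G o n y)
          (E n y (regionInclusion (prev_subset_plaquette G o n y) a)) =
        restrictState φ₀ (prev G o n y) a)
    {l : List V} (hl : l.Nodup) (hlevel : ∀ y ∈ l, y ∈ level G o n) {D : Set V}
    (hD : ∀ y ∈ l, y ∉ D ∧ Disjoint (succ G o n y : Set V) D) {t : LocalAlgebra A}
    (ht : t ∈ supportedOn A D) : φ₀ (toQuasi (levelMap E n l t)) = φ₀ (toQuasi t) := by
  induction l generalizing D t with
  | nil => rfl
  | cons y l ih =>
    rw [List.nodup_cons] at hl
    have hy : y ∈ level G o n := hlevel y List.mem_cons_self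
    have hDy := hD y List.mem_cons_self
    have hlevel' : ∀ z ∈ l, z ∈ level G o n := fun z hz => hlevel z (List.mem_cons_of_mem _ hz)
    -- The induction hypothesis is used for the support of the image, `D` without the plaquette of
    -- `y` but with `N_y^{(s)}`. It remains to see that this set still avoids the later vertices and
    -- their successors, and that `D` meets the plaquette of `y` only in `N_y^{(p)}`.
    refine (ih hl.2 hlevel' (fun z hz => ?_) (ampliation_mem_supportedOn (E n y) ht)).trans
      (hφ.apply_ampliation (E n y) (prev_subset_plaquette G o n y) (succ_subset_plaquette n y)
        (hcompat y hy) (fun x hx hxD => ?_) ht)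
    · have hz' := hlevel' z hz
      have hzD := hD z (List.mem_cons_of_mem _ hz)
      have hzy : z ≠ y := fun h => hl.1 (h ▸ hz)
      refine ⟨?_, Set.disjoint_union_right.2 ⟨hzD.2.mono_right Set.sdiff_subset, ?_⟩⟩
      · rintro (h | h)
        · exact hzD.1 h.1
        · exact notMem_succ_of_mem_level hbip hy hz' h
      · exact_mod_cast hsucc z hz' y hy hzy
    · exact mem_prev_of_mem_plaquette (hrest y hy) hx (fun h => hDy.1 (h ▸ hxD))
        fun h => Set.disjoint_left.1 hDy.2 h hxD

variable {enum : ℕ → List V}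

theorem forwardMap_one (hE : ∀ n, ∀ y ∈ enum n, IsTransitionExpectation (E n y)) (n : ℕ) :
    forwardMap E enum n 1 = 1 := by
  induction n with
  | zero => exact levelMap_one (hE 0)
  | succ n ih => rw [forwardMap, LinearMap.comp_apply, ih, levelMap_one (hE (n + 1))]

theorem forwardMap_mem_sumsOfSquares
    (hE : ∀ n, ∀ y ∈ enum n, IsTransitionExpectation (E n y)) (n : ℕ) (b : LocalAlgebra A) :
    forwardMap E enum n (star b * b) ∈ sumsOfSquares (LocalAlgebra A) := by
  induction n with
  | zero => exact levelMap_mem_sumsOfSquares (hE 0) (AddSubmonoid.subset_closure ⟨b, rfl⟩)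
  | succ n ih => exact levelMap_mem_sumsOfSquares (hE (n + 1)) ih

/-- Up to level `n` all new support consists of successors inside `V_{n+1}`, so the observable never
reaches the next level. -/
theorem forwardMap_mem_supportedOn {n : ℕ} {D : Set V} (hD : ball G o (n + 1) ⊆ D)
    {t : LocalAlgebra A} (ht : t ∈ supportedOn A D) :
    forwardMap E enum n t ∈ supportedOn A D := by
  induction n with
  | zero => exact levelMap_mem_supportedOn hD _ ht
  | succ n ih =>
    exact levelMap_mem_supportedOn hD _ (ih ((ball_mono (n + 1).le_succ).trans hD))

end ForwardMaps

/-! ### Limits of sequences of states -/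

section Limit

variable {V : Type u} {A : V → Type v} [∀ x, CStarAlgebra (A x)]

/-- States on the quasi-local algebra that converge on the local observables converge pointwise. -/
theorem tendsto_of_tendsto_local {Φ : ℕ → (QuasiLocalAlgebra A →ₗ[ℂ] ℂ)}
    {ω : QuasiLocalAlgebra A →ₗ[ℂ] ℂ} (hΦ : ∀ n, IsState (Φ n)) (hω : IsState ω)
    (h : ∀ a : LocalAlgebra A,
      Filter.Tendsto (fun n => Φ n (toQuasi a)) Filter.atTop (nhds (ω (toQuasi a))))
    (a : QuasiLocalAlgebra A) :
    Filter.Tendsto (fun n => Φ n a) Filter.atTop (nhds (ω a)) := by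
  rw [Metric.tendsto_atTop]
  intro ε hε
  obtain ⟨b, hb⟩ := toQuasi_denseRange.exists_dist_lt a (show (0 : ℝ) < ε / 3 by positivity)
  obtain ⟨N, hN⟩ := Metric.tendsto_atTop.1 (h b) (ε / 3) (by positivity)
  have hlip : ∀ {ψ : QuasiLocalAlgebra A →ₗ[ℂ] ℂ}, IsState ψ →
      dist (ψ a) (ψ (toQuasi b)) < ε / 3 := by
    intro ψ hψ
    rw [dist_eq_norm, ← map_sub]
    exact (hψ.norm_apply_le _).trans_lt (by rwa [← dist_eq_norm])
  refine ⟨N, fun n hn => ?_⟩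
  have h1 := hlip (hΦ n)
  have h2 := hN n hn
  have h3 := hlip hω
  rw [dist_comm] at h3
  have := dist_triangle4 (Φ n a) (Φ n (toQuasi b)) (ω (toQuasi b)) (ω a)
  linarith

/-- A pointwise eventually constant sequence of states on the local algebra has a limit state. -/
theorem exists_limit_state {f : ℕ → (LocalAlgebra A →ₗ[ℂ] ℂ)}
    (hf : ∀ n b, 0 ≤ f n (star b * b)) (h1 : ∀ n, f n 1 = 1)
    (hconst : ∀ a, ∃ n₀, ∀ n ≥ n₀, f n a = f n₀ a) :
    ∃ ω : QuasiLocalAlgebra A →ₗ[ℂ] ℂ, IsState ω ∧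
      ∀ a, ∃ n₀, ∀ n ≥ n₀, f n a = ω (toQuasi a) := by
  choose N hN using hconst
  -- The eventual value, taken at a stage depending on `a`, is linear in `a` because it is a
  -- pointwise limit of linear maps. Positivity and normalization hold at every stage, hence for
  -- this value.
  have htend : Filter.Tendsto (fun n a => f n a) Filter.atTop (nhds fun a => f (N a) a) := by
    rw [tendsto_pi_nhds]
    intro a
    exact tendsto_const_nhds.congr'
      ((Filter.eventually_ge_atTop (N a)).mono fun n hn => (hN a n hn).symm)
  obtain ⟨ω, hω, hωf⟩ := exists_state_extension
    (f := linearMapOfTendsto (fun a => f (N a) a) f htend) (fun b => hf _ b) (h1 _)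
  exact ⟨ω, hω, fun a => ⟨N a, fun n hn => (hN a n hn).trans (hωf a).symm⟩⟩

end Limit

end QMF

end

/-! ### The forward quantum Markov field -/

theorem theorem5p3 {V : Type*} [Infinite V] (G : SimpleGraph V) [G.LocallyFinite]
    (hconn : G.Connected) (o : V)
    (hbip : ∀ x y, G.Adj x y → (x ∈ QMF.allCenters G o ↔ y ∉ QMF.allCenters G o))
    (hrest : ∀ n, ∀ y ∈ QMF.level G o n, QMF.rest G o n y = ∅)
    (hsucc : ∀ n, ∀ y ∈ QMF.level G o n, ∀ z ∈ QMF.level G o n, y ≠ z →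
      Disjoint (QMF.succ G o n y) (QMF.succ G o n z))
    (enum : ℕ → List V)
    (henum : ∀ n, (enum n).Nodup ∧ ∀ y, y ∈ enum n ↔ y ∈ QMF.level G o n)
    (A : V → Type*) [∀ x, CStarAlgebra (A x)] [∀ x, FiniteDimensional ℂ (A x)]
    (φ : ∀ x, A x →ₗ[ℂ] ℂ) (φ₀ : QMF.QuasiLocalAlgebra A →ₗ[ℂ] ℂ)
    (hφ : QMF.IsProductState φ₀ φ)
    (E : QMF.TransitionFamily G o A)
    (hE : ∀ n, ∀ y ∈ QMF.level G o n, QMF.IsTransitionExpectation (E n y))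
    (hcompat : ∀ n, ∀ y ∈ QMF.level G o n, ∀ a : QMF.RegionAlgebra A (QMF.prev G o n y),
      QMF.restrictState φ₀ (QMF.succ G o n y)
          (E n y (QMF.regionInclusion (QMF.prev_subset_plaquette G o n y) a)) =
        QMF.restrictState φ₀ (QMF.prev G o n y) a) :
    -- each `φ_n` is a well-defined state on the quasi-local algebra
    (∀ n, ∃! ψ, QMF.IsForwardState φ₀ E enum n ψ) ∧
    ∃ φ' : QMF.QuasiLocalAlgebra A →ₗ[ℂ] ℂ,
      -- there is exactly one forward quantum Markov field
      (∀ ψ, QMF.IsForwardQMF φ₀ E enum ψ ↔ ψ = φ') ∧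
      -- the sequence of the states `φ_n` converges to it in the strongly finite sense and
      -- pointwise, and to no other state
      ∀ Φ : ℕ → (QMF.QuasiLocalAlgebra A →ₗ[ℂ] ℂ),
        (∀ n, QMF.IsForwardState φ₀ E enum n (Φ n)) →
          (∀ ψ, (QMF.IsState ψ ∧ QMF.StronglyFiniteTendsto Φ ψ) ↔ ψ = φ') ∧
          ∀ a, Filter.Tendsto (fun n => Φ n a) Filter.atTop (nhds (φ' a)) := by
  have hE' : ∀ n, ∀ y ∈ enum n, QMF.IsTransitionExpectation (E n y) := fun n y hy =>
    hE n y (((henum n).2 y).1 hy)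
  let f : ℕ → (QMF.LocalAlgebra A →ₗ[ℂ] ℂ) := fun n =>
    φ₀ ∘ₗ QMF.toQuasi.toAlgHom.toLinearMap ∘ₗ QMF.forwardMap E enum n
  have hf : ∀ n a, f n a = φ₀ (QMF.toQuasi (QMF.forwardMap E enum n a)) := fun _ _ => rfl
  have hφ₀ : ∀ b, 0 ≤ (φ₀ ∘ₗ QMF.toQuasi.toAlgHom.toLinearMap) (star b * b) := by
    intro b
    change 0 ≤ φ₀ (QMF.toQuasi (star b * b))
    rw [map_mul, map_star]
    exact hφ.isState.nonneg _
  have hpos : ∀ n b, 0 ≤ f n (star b * b) := fun n b =>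
    QMF.nonneg_apply_of_mem_sumsOfSquares hφ₀ (QMF.forwardMap_mem_sumsOfSquares hE' n b)
  have hone : ∀ n, f n 1 = 1 := by
    intro n
    rw [hf, QMF.forwardMap_one hE', map_one, hφ.isState.map_one]
  have hconst : ∀ a, ∃ n₀, ∀ n ≥ n₀, f n a = f n₀ a := by
    intro a
    obtain ⟨Λ, ha⟩ := QMF.exists_finset_mem_supportedOn a
    obtain ⟨N, hN⟩ := QMF.exists_subset_ball (o := o) hconn Λ
    refine ⟨N, fun n hn => ?_⟩
    induction n, hn using Nat.le_induction with
    | base => rfl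
    | succ n hn ih =>
      rw [← ih]
      have han : a ∈ QMF.supportedOn A (QMF.ball G o (n + 1)) :=
        QMF.supportedOn_mono (hN.trans (QMF.ball_mono (hn.trans n.le_succ))) ha
      -- Passing from `φ_n` to `φ_{n+1}` inserts the maps of level `n+1` outermost. They act on an
      -- observable supported in `V_{n+1}`, which contains neither a vertex of that level nor a
      -- successor of one.
      refine hφ.apply_levelMap hbip (hrest (n + 1)) (hsucc (n + 1)) (hcompat (n + 1))
        (henum (n + 1)).1 (fun y hy => ((henum (n + 1)).2 y).1 hy) (fun y hy => ?_)
        (QMF.forwardMap_mem_supportedOn subset_rfl han)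
      exact ⟨(((henum (n + 1)).2 y).1 hy).1, QMF.disjoint_succ_ball n y⟩
  have hexists : ∀ n, ∃ ψ, QMF.IsForwardState φ₀ E enum n ψ := by
    intro n
    obtain ⟨ψ, hψ, hψf⟩ := QMF.exists_state_extension (hpos n) (hone n)
    exact ⟨ψ, hψ, hψf⟩
  obtain ⟨φ', hφ', hlim⟩ := QMF.exists_limit_state hpos hone hconst
  have hfinite : ∀ Φ : ℕ → (QMF.QuasiLocalAlgebra A →ₗ[ℂ] ℂ),
      (∀ n, QMF.IsForwardState φ₀ E enum n (Φ n)) → QMF.StronglyFiniteTendsto Φ φ' :=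
    fun Φ hΦ a => (hlim a).imp fun N hN n hn => ((hΦ n).apply_local a).trans (hN n hn)
  have htend : ∀ Φ : ℕ → (QMF.QuasiLocalAlgebra A →ₗ[ℂ] ℂ),
      (∀ n, QMF.IsForwardState φ₀ E enum n (Φ n)) →
        ∀ a, Filter.Tendsto (fun n => Φ n a) Filter.atTop (nhds (φ' a)) := by
    intro Φ hΦ
    refine QMF.tendsto_of_tendsto_local (fun n => (hΦ n).isState) hφ' fun a => ?_
    obtain ⟨N, hN⟩ := hfinite Φ hΦ a
    exact tendsto_const_nhds.congr'
      ((Filter.eventually_ge_atTop N).mono fun n hn => (hN n hn).symm)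
  refine ⟨fun n => ?_, φ', fun ψ => ⟨?_, ?_⟩, fun Φ hΦ => ⟨fun ψ => ⟨?_, ?_⟩, htend Φ hΦ⟩⟩
  · obtain ⟨ψ, hψ⟩ := hexists n
    exact ⟨ψ, hψ, fun ψ' hψ' => hψ'.isState.ext_local hψ.isState fun a =>
      (hψ'.apply_local a).trans (hψ.apply_local a).symm⟩
  · rintro ⟨-, Φ, hΦ, hcluster⟩
    have h := tendsto_pi_nhds.2 (htend Φ hΦ)
    -- Uniqueness of limits: the sequence converges pointwise to `φ'`, so a cluster point has no
    -- neighborhood disjoint from one of `φ'`, and the product topology is Hausdorff.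
    exact DFunLike.coe_injective (eq_of_nhds_neBot (hcluster.clusterPt.mono h))
  · rintro rfl
    choose Φ hΦ using hexists
    exact ⟨hφ', Φ, hΦ, (tendsto_pi_nhds.2 (htend Φ hΦ)).mapClusterPt⟩
  · rintro ⟨hψ, hψΦ⟩
    refine hψ.ext_local hφ' fun a => ?_
    obtain ⟨N, hN⟩ := hψΦ a
    obtain ⟨M, hM⟩ := hfinite Φ hΦ a
    exact (hN _ (le_max_left N M)).symm.trans (hM _ (le_max_right N M))
  · rintro rfl
    exact ⟨hφ', hfinite Φ hΦ⟩
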